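/- **Setting.** Consider a Markov decision process with measurable state space $\mathcal S\subseteq\mathbb R^{n_s}$, open action space $\mathcal A\subseteq\mathbb R^{n_a}$, initial probability density $p_1$ on $\mathcal S$, transition probability density $p(s'|s,a)$ on $\mathcal S$, stage cost $\ell(s,a)\in\mathbb R$ and discount factor $\gamma\in(0,1]$. For a measurable policy $\pi:\mathcal S\to\mathcal A$, let $s_0,s_1,\dots$ be the Markov chain with transition density $p(\cdot|s,\pi(s))$, and let $$V^\pi(s)=\mathbb E\Big[\sum_{t\ge0}\gamma^t\ell(s_t,\pi(s_t))\,\Big|\,s_0=s\Big],\qquad Q^\pi(s,a)=\ell(s,a)+\gamma\int_{\mathcal S}p(s'|s,a)V^\pi(s')\,ds' .$$ Let $\pi_\theta$, $\theta\in\mathbb R^{n_\theta}$, be a parametrized family of policies $\mathcal S\to\mathcal A$, let $J(\theta)=\int_{\mathcal S} p_1(s)V^{\pi_\theta}(s)\,ds$, and let $$H(\theta)=\mathbb E_s\Big[\nabla_\theta^2\pi_\theta(s)\otimes\nabla_aQ^{\pi_\theta}(s,a)+\nabla_\theta\pi_\theta(s)\,\nabla_a^2Q^{\pi_\theta}(s,a)\,\nabla_\theta\pi_\theta(s)^\top\Big]_{a=\pi_\theta(s)},$$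 where $(\nabla_\theta\pi_\theta)_{ik}=\partial_{\theta_i}(\pi_\theta)_k$, $(T\otimes v)_{ij}=\sum_k v_kT_{ijk}$, and $\mathbb E_s[f(s)]=\sum_{t\ge0}\gamma^t\,\mathbb E[f(s_t)]$ for the chain with policy $\pi_\theta$ and $s_0\sim p_1$. A policy $\pi^\star$ is optimal if, for every $s$, its expected discounted cost from $s$ converges absolutely and $V^{\pi^\star}(s)\le V^{\pi}(s)$ for every policy $\pi$ whose expected discounted cost from $s$ converges absolutely. **Assumptions.** 1. $p,\nabla_ap,\pi_\theta(s),\nabla_\theta\pi_\theta(s),\ell,\nabla_a\ell,p_1$ exist and are continuous in all variables; $p_1$, $p$, $\nabla_a\ell$, $\nabla_ap$ are bounded; and for some $\theta$ the expected discounted cost of $\pi_\theta$ from $s_0\sim p_1$ converges absolutely. 2. $\nabla_a^2p,\nabla_\theta^2\pi_\theta(s),\nabla_a^2\ell$ exist and are continuous in all variables; $\nabla^2_ap$ and $\nabla^2_a\ell$ are bounded. 3. $\theta^\star$ is such that $\pi_{\theta^\star}$ is an optimal policy, and in a neighbourhood of $\theta^\star$ the function $J$ is twice continuously differentiable with Lipschitz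 continuous, invertible Hessian. 4. Either $\mathcal S$ is compact and $\gamma<1$, or, more generally, there are a measurable $W:\mathcal S\to[0,\infty)$ with $\int p_1W<\infty$, constants $C$ and $\lambda\in[0,1)$, and a neighbourhood $U$ of $\theta^\star$ such that: for all $\theta\in U$, $s\in\mathcal S$, $\gamma\int p(s'|s,\pi_\theta(s))W(s')\,ds'\le\lambda W(s)$, and $\ell(s,\pi_\theta(s))$ and its first and second derivatives in $\theta$ are bounded in norm by $CW(s)$; for every $s$ there is a measurable $g$ with $\int gW\le CW(s)$ that bounds $s'\mapsto\|\nabla_\theta^j[p(s'|s,\pi_\theta(s))]\|$ for $j=1,2$ and all $\theta\in U$; and for all $\theta\in U$ and $s$ there is a measurable $g$ with $\int gW<\infty$ that bounds $s'\mapsto\|\nabla_a^jp(s'|s,a)\|$ for $j=1,2$ and all $a$ in a neighbourhood of $\pi_\theta(s)$. **Statement.** Suppose moreover that $\nabla J(\theta^\star)=0$ and $\nabla^2J(\theta^\star)$ is positive definite, and that the sequence given by the quasi-Newton update with unit step $$\theta_{k+1}=\theta_k-H(\theta_k)^{-1}\nabla J(\theta_k),\qquad k\ge0,$$ converges to $\theta^\star$.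 Then it converges superlinearly: $\|\theta_{k+1}-\theta^\star\|=o(\|\theta_k-\theta^\star\|)$ as $k\to\infty$, i.e. $\|\theta_{k+1}-\theta^\star\|/\|\theta_k-\theta^\star\|\to0$ whenever $\theta_k\ne\theta^\star$ for all $k$. -/

import Mathlib

open MeasureTheory Filter Topology Asymptotics

noncomputable section

namespace QNPolicy

/-- Euclidean space `ℝⁿ`. -/
abbrev E (n : ℕ) := EuclideanSpace ℝ (Fin n)

/-- The Hessian matrix `(∂ᵢ∂ⱼ f(x))ᵢⱼ` of a real function on `ℝⁿ`. -/
def hessian {n : ℕ} (f : E n → ℝ) (x : E n) : Matrix (Fin n) (Fin n) ℝ :=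
  Matrix.of fun i j =>
    fderiv ℝ (fderiv ℝ f) x (EuclideanSpace.single i 1) (EuclideanSpace.single j 1)

/-- Lebesgue measure on a (measurable) subset `S` of `ℝⁿ`, as a measure on the subtype. -/
def leb {n : ℕ} (S : Set (E n)) : Measure S := Measure.comap Subtype.val volume

/-- A discounted Markov decision process with state space `S ⊆ ℝ^{ns}`, action space
`A ⊆ ℝ^{na}`, initial density `p₁`, transition density `p s a s' = p(s' | s, a)`
(densities with respect to Lebesgue measure on `S`), stage cost `ℓ` and discount factor `γ`.
The functions of the action are only meaningful for actions in the open set `A`. -/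
structure MDP (ns na : ℕ) where
  S : Set (E ns)
  measurableSet_S : MeasurableSet S
  A : Set (E na)
  isOpen_A : IsOpen A
  p₁ : S → ℝ
  p₁_nonneg : ∀ s, 0 ≤ p₁ s
  lintegral_p₁ : ∫⁻ s, ENNReal.ofReal (p₁ s) ∂leb S = 1
  p : S → E na → S → ℝ
  p_nonneg : ∀ s, ∀ a ∈ A, ∀ s', 0 ≤ p s a s'
  lintegral_p : ∀ s, ∀ a ∈ A, ∫⁻ s', ENNReal.ofReal (p s a s') ∂leb S = 1
  ℓ : S → E na → ℝ
  γ : ℝ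
  γ_pos : 0 < γ
  γ_le_one : γ ≤ 1

namespace MDP

variable {ns na nθ : ℕ} (M : MDP ns na)

/-- The initial state distribution. -/
def init : Measure M.S := (leb M.S).withDensity fun s => ENNReal.ofReal (M.p₁ s)

/-- The law of the state `s_t` in closed loop with the policy `π`, when `s_0` has law `μ`. -/
def law (μ : Measure M.S) (π : M.S → E na) : ℕ → Measure M.S
  | 0 => μ
  | t + 1 => (leb M.S).withDensity fun s' =>
      ∫⁻ s, ENNReal.ofReal (M.p s (π s) s') ∂(law μ π t)

/-- The (unnormalised) discounted state distribution `∑ₜ γᵗ Law(s_t)`. -/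
def occ (μ : Measure M.S) (π : M.S → E na) : Measure M.S :=
  Measure.sum fun t => ENNReal.ofReal (M.γ ^ t) • M.law μ π t

/-- The expected discounted cost of `π` from the initial law `μ` converges absolutely. -/
def FiniteCost (μ : Measure M.S) (π : M.S → E na) : Prop :=
  ∫⁻ s, ‖M.ℓ s (π s)‖ₑ ∂(M.occ μ π) < ⊤

/-- The value function `V^π(s) = 𝔼[∑ₜ γᵗ ℓ(s_t, π(s_t)) | s_0 = s]`. -/
def V (π : M.S → E na) (s : M.S) : ℝ :=
  ∫ s', M.ℓ s' (π s') ∂(M.occ (Measure.dirac s) π)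

/-- The action-value function `Q^π(s,a) = ℓ(s,a) + γ ∫ p(s'|s,a) V^π(s') ds'`. -/
def Q (π : M.S → E na) (s : M.S) (a : E na) : ℝ :=
  M.ℓ s a + M.γ * ∫ s', M.p s a s' * M.V π s' ∂leb M.S

/-- The performance `J(θ) = 𝔼_{s₀}[V^{π_θ}(s₀)]`. -/
def J (π : E nθ → M.S → E na) (θ : E nθ) : ℝ :=
  ∫ s, M.V (π θ) s ∂M.init

/-- `π` is an optimal policy: from every state it has finite cost, and its value is at most the
value of every (measurable, deterministic) policy whose cost from that state is finite. -/
def IsOptimal (π : M.S → E na) : Prop :=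
  (∀ s, FiniteCost M (Measure.dirac s) π) ∧
  ∀ π' : M.S → E na, Measurable π' → (∀ s, π' s ∈ M.A) →
    ∀ s, FiniteCost M (Measure.dirac s) π' → M.V π s ≤ M.V π' s

end MDP

section policy

variable {X : Type*} {na nθ : ℕ}

/-- The matrix `∇_θ π_θ(s) ∈ ℝ^{nθ × na}` with entries `∂(π_θ(s))_k / ∂θ_i`. -/
def policyJac (π : E nθ → X → E na) (θ : E nθ) (s : X) : Matrix (Fin nθ) (Fin na) ℝ :=
  Matrix.of fun i k => fderiv ℝ (fun ϑ => π ϑ s) θ (EuclideanSpace.single i 1) k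

/-- The tensor `∇²_θ π_θ(s) ∈ ℝ^{nθ × nθ × na}`. -/
def policyHess (π : E nθ → X → E na) (θ : E nθ) (s : X) (i j : Fin nθ) (k : Fin na) : ℝ :=
  fderiv ℝ (fderiv ℝ (fun ϑ => π ϑ s)) θ
    (EuclideanSpace.single i 1) (EuclideanSpace.single j 1) k

/-- The product `T ⊗ v = ∑ₖ vₖ T(:,:,k)` of a tensor and a vector. -/
def tensorVec {n₁ n₂ n₃ : ℕ} (T : Fin n₁ → Fin n₂ → Fin n₃ → ℝ) (v : E n₃) :
    Matrix (Fin n₁) (Fin n₂) ℝ :=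
  Matrix.of fun i j => ∑ k, v k * T i j k

end policy

namespace MDP

variable {ns na nθ : ℕ} (M : MDP ns na)

/-- The matrix under the expectation in the approximate Hessian:
`∇²_θ π_θ(s) ⊗ ∇_a Q(s,a) + ∇_θ π_θ(s) ∇²_a Q(s,a) ∇_θ π_θ(s)ᵀ` at `a = π_θ(s)`. -/
def hessIntegrand (π : E nθ → M.S → E na) (θ : E nθ) (s : M.S) : Matrix (Fin nθ) (Fin nθ) ℝ :=
  tensorVec (policyHess π θ s) (gradient (M.Q (π θ) s) (π θ s)) +
    policyJac π θ s * hessian (M.Q (π θ) s) (π θ s) * (policyJac π θ s).transpose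

/-- The approximate Hessian `H(θ)`: the expectation of `hessIntegrand` over the discounted
state distribution in closed loop with `π_θ`. -/
def H (π : E nθ → M.S → E na) (θ : E nθ) : Matrix (Fin nθ) (Fin nθ) ℝ :=
  Matrix.of fun i j => ∫ s, M.hessIntegrand π θ s i j ∂(M.occ M.init (π θ))

/-- First-order regularity of the data: `p`, `∇_a p`, `π`, `∇_θ π`, `ℓ`, `∇_a ℓ`, `p₁` exist and are
continuous in all variables, with uniform bounds on `p₁`, `p`, `∇_a ℓ`, `∇_a p`, and some policy
of the family has finite performance. -/
structure FirstOrderRegular (π : E nθ → M.S → E na) : Prop where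
  mapsTo : ∀ θ s, π θ s ∈ M.A
  p_cont : ContinuousOn (fun x : M.S × E na × M.S => M.p x.1 x.2.1 x.2.2) {x | x.2.1 ∈ M.A}
  p_diff : ∀ s s', DifferentiableOn ℝ (fun a => M.p s a s') M.A
  dp_cont : ContinuousOn
    (fun x : M.S × E na × M.S => fderiv ℝ (fun a => M.p x.1 a x.2.2) x.2.1) {x | x.2.1 ∈ M.A}
  π_cont : Continuous fun x : E nθ × M.S => π x.1 x.2
  π_diff : ∀ s, Differentiable ℝ fun θ => π θ s
  dπ_cont : Continuous fun x : E nθ × M.S => fderiv ℝ (fun θ => π θ x.2) x.1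
  ℓ_cont : ContinuousOn (fun x : M.S × E na => M.ℓ x.1 x.2) {x | x.2 ∈ M.A}
  ℓ_diff : ∀ s, DifferentiableOn ℝ (M.ℓ s) M.A
  dℓ_cont : ContinuousOn (fun x : M.S × E na => fderiv ℝ (M.ℓ x.1) x.2) {x | x.2 ∈ M.A}
  p₁_cont : Continuous M.p₁
  bounds : ∃ b L : ℝ, (∀ s, M.p₁ s < b) ∧ (∀ s, ∀ a ∈ M.A, ∀ s', M.p s a s' < b) ∧
    (∀ s, ∀ a ∈ M.A, ‖fderiv ℝ (M.ℓ s) a‖ < L) ∧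
    (∀ s, ∀ a ∈ M.A, ∀ s', ‖fderiv ℝ (fun a => M.p s a s') a‖ < L)
  finite : ∃ θ, M.FiniteCost M.init (π θ)

/-- Second-order regularity of the data: `∇²_a p`, `∇²_θ π`, `∇²_a ℓ` exist and are continuous in all
variables, with uniform bounds on `∇²_a p` and `∇²_a ℓ`. -/
structure SecondOrderRegular (π : E nθ → M.S → E na) : Prop where
  p_diff : ∀ s s', DifferentiableOn ℝ (fderiv ℝ (fun a => M.p s a s')) M.A
  ddp_cont : ContinuousOn
    (fun x : M.S × E na × M.S => fderiv ℝ (fderiv ℝ (fun a => M.p x.1 a x.2.2)) x.2.1)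
    {x | x.2.1 ∈ M.A}
  π_diff : ∀ s, Differentiable ℝ (fderiv ℝ fun θ => π θ s)
  ddπ_cont : Continuous fun x : E nθ × M.S => fderiv ℝ (fderiv ℝ fun θ => π θ x.2) x.1
  ℓ_diff : ∀ s, DifferentiableOn ℝ (fderiv ℝ (M.ℓ s)) M.A
  ddℓ_cont : ContinuousOn
    (fun x : M.S × E na => fderiv ℝ (fderiv ℝ (M.ℓ x.1)) x.2) {x | x.2 ∈ M.A}
  bounds : ∃ B : ℝ,
    (∀ s, ∀ a ∈ M.A, ∀ s', ‖fderiv ℝ (fderiv ℝ (fun a => M.p s a s')) a‖ < B) ∧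
    (∀ s, ∀ a ∈ M.A, ‖fderiv ℝ (fderiv ℝ (M.ℓ s)) a‖ < B)

/-- Weighted domination of the data near `θs`, for state spaces that are not compact (or `γ = 1`).
There is a weight `W ≥ 0`, integrable for the initial law, such that for `θ` near `θs`
the closed-loop transition contracts `W` after discounting, the stage cost and its first two
`θ`-derivatives are `O(W)`, the first two `θ`-derivatives of the closed-loop transition density have
an envelope with `W`-integral `O(W)`, and the first two action derivatives of the density are
locally dominated by a function with finite `W`-integral. -/
def LocallyDominated (π : E nθ → M.S → E na) (θs : E nθ) : Prop :=
  ∃ W : M.S → ℝ, Measurable W ∧ (∀ s, 0 ≤ W s) ∧ Integrable W M.init ∧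
  ∃ C lam : ℝ, 0 ≤ lam ∧ lam < 1 ∧ ∃ U ∈ 𝓝 θs,
    (∀ θ ∈ U, ∀ s, ENNReal.ofReal M.γ *
      ∫⁻ s', ENNReal.ofReal (M.p s (π θ s) s') * ENNReal.ofReal (W s') ∂leb M.S ≤
        ENNReal.ofReal (lam * W s)) ∧
    (∀ θ ∈ U, ∀ s, |M.ℓ s (π θ s)| ≤ C * W s ∧
      ‖fderiv ℝ (fun ϑ => M.ℓ s (π ϑ s)) θ‖ ≤ C * W s ∧
      ‖fderiv ℝ (fderiv ℝ (fun ϑ => M.ℓ s (π ϑ s))) θ‖ ≤ C * W s) ∧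
    (∀ s, ∃ g : M.S → ℝ, Measurable g ∧
      (∀ θ ∈ U, ∀ s', ‖fderiv ℝ (fun ϑ => M.p s (π ϑ s) s') θ‖ ≤ g s' ∧
        ‖fderiv ℝ (fderiv ℝ (fun ϑ => M.p s (π ϑ s) s')) θ‖ ≤ g s') ∧
      ∫⁻ s', ENNReal.ofReal (g s') * ENNReal.ofReal (W s') ∂leb M.S ≤ ENNReal.ofReal (C * W s)) ∧
    (∀ θ ∈ U, ∀ s, ∃ N ∈ 𝓝 (π θ s), ∃ g : M.S → ℝ, Measurable g ∧
      (∀ a ∈ N, ∀ s', ‖fderiv ℝ (fun a => M.p s a s') a‖ ≤ g s' ∧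
        ‖fderiv ℝ (fderiv ℝ (fun a => M.p s a s')) a‖ ≤ g s') ∧
      ∫⁻ s', ENNReal.ofReal (g s') * ENNReal.ofReal (W s') ∂leb M.S < ⊤)

end MDP

/-- In a neighbourhood of `x`, `f` is twice continuously differentiable and its Hessian is
Lipschitz and invertible. -/
def LipschitzInvertibleHessianNear {n : ℕ} (f : E n → ℝ) (x : E n) : Prop :=
  ∃ U : Set (E n), IsOpen U ∧ x ∈ U ∧ ContDiffOn ℝ 2 f U ∧
    (∃ K, LipschitzOnWith K (fderiv ℝ (fderiv ℝ f)) U) ∧ ∀ y ∈ U, IsUnit (hessian f y)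

/-- Superlinear convergence `‖x_{k+1} - L‖ / ‖x_k - L‖ → 0`, in the form
`‖x_{k+1} - L‖ = o(‖x_k - L‖)`, which is also meaningful if some `x_k = L`. -/
def SuperlinearlyConverges {n : ℕ} (x : ℕ → E n) (L : E n) : Prop :=
  Tendsto x atTop (𝓝 L) ∧ (fun k => x (k + 1) - L) =o[atTop] fun k => x k - L

end QNPolicy

end

noncomputable section

namespace QNPolicy

open ProbabilityTheory

/-! ### The closed-loop chain of a fixed policy -/

/-! Superlinear convergence follows once `H θ` tends to `∇²J(θs)`. With `A = ∇²J(θs)`, `B = H(θ_k)`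
and `e = θ_k - θs`, the new error is `(1 - B⁻¹A) e - B⁻¹(∇J(θ_k) - A e)`, and both terms are
`o(‖e‖)` (`superlinearlyConverges_of_quasiNewton`). So two facts are needed: `H` is continuous at
`θs`, and `H θs = ∇²J(θs)`.

For the second fact, let `L_s(ϑ)` be the cost of one step under `π_ϑ` followed by the terminal cost
`V^{π_θs}` (`lookahead`), and let `gap` be `L_s(θ) - V^{π_θs}(s)`. The performance difference
identity `V_sub_eq` writes `V^{π_θ} - V^{π_θs}` as the discounted total of `gap` along the chain of
`π_θ`. Optimality makes this difference nonnegative at every state. Dividing by `t` along the lines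
`θs ± t v` shows that the total of `DL_s(θs) v` along the chain of `π_θs` vanishes from every state;
the Bellman recursion then gives `DL_s(θs) = 0` pointwise (`fderiv_lookahead_eq_zero`). Hence `gap`
is of order `t²`. Replacing the chain of `π_θ` by that of `π_θs` changes its total only at order
`t³`, so the quadratic form of `∇²J(θs)` is the discounted expectation of `D²L_s(θs)`
(`fderiv₂_J_self`). Polarization and the chain rule identify this with `H θs` (`H_self`,
`hessIntegrand_eq`).

All estimates use the norm weighted by `W`: since the discounted transition contracts `W` by `lam <
1`, totals of functions bounded by `c W` are bounded by `c W / (1 - lam)`, uniformly for `θ` near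
`θs`. This uniformity also gives the continuity of `H` by dominated convergence (`tendsto_H`). A
compact state space with `γ < 1` is the case `W = 1`, `lam = γ`. -/

instance sigmaFinite_leb {n : ℕ} (S : Set (E n)) [hS : Fact (MeasurableSet S)] :
    SigmaFinite (leb S) := by
  have h : Measure.map Subtype.val (leb S) = (volume : Measure (E n)).restrict S :=
    map_comap_subtype_coe hS.out _
  refine SigmaFinite.of_map (leb S) measurable_subtype_coe.aemeasurable ?_
  rw [h]
  infer_instance

theorem integral_bind_kernel {X Y : Type*} [MeasurableSpace X] [MeasurableSpace Y]
    (μ : Measure X) (κ : Kernel X Y) {f : Y → ℝ} (hf : Integrable f (μ.bind κ)) :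
    ∫ y, f y ∂(μ.bind κ) = ∫ x, ∫ y, f y ∂κ x ∂μ := by
  have h : (κ ∘ₖ Kernel.const Unit μ) () = μ.bind κ := by
    rw [Kernel.comp_apply, Kernel.const_apply]
  have := Kernel.integral_comp (η := κ) (κ := Kernel.const Unit μ) (a := ()) (f := f) (by rwa [h])
  simpa [h] using this

namespace MDP

variable {ns na nθ : ℕ} (M : MDP ns na)

instance factMeasurableSet_S : Fact (MeasurableSet M.S) := ⟨M.measurableSet_S⟩

/-- The closed-loop transition density of the policy is nonnegative and jointly measurable. -/
structure Admissible (π : M.S → E na) : Prop where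
  measurable : Measurable fun x : M.S × M.S => M.p x.1 (π x.1) x.2
  nonneg : ∀ s s', 0 ≤ M.p s (π s) s'

/-- The transition kernel of the closed loop. -/
def stepKernel (π : M.S → E na) : Kernel M.S M.S :=
  Kernel.withDensity (Kernel.const _ (leb M.S)) fun s s' => ENNReal.ofReal (M.p s (π s) s')

/-- The `t`-step transition kernel of the closed loop. -/
def iterKernel (π : M.S → E na) : ℕ → Kernel M.S M.S
  | 0 => Kernel.id
  | t + 1 => M.stepKernel π ∘ₖ iterKernel π t

/-- The kernel sending a state to the discounted state distribution started there. -/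
def occKernel (π : M.S → E na) : Kernel M.S M.S where
  toFun s := Measure.sum fun t => ENNReal.ofReal (M.γ ^ t) • M.iterKernel π t s
  measurable' := by
    refine Measure.measurable_of_measurable_coe _ fun B hB => ?_
    simp only [Measure.sum_apply _ hB, Measure.smul_apply, smul_eq_mul]
    exact Measurable.tsum fun t =>
      ((M.iterKernel π t).measurable_coe hB).const_mul _

variable {M} {π : M.S → E na}

namespace Admissible

variable (hπ : M.Admissible π)
include hπ

theorem measurable_density (s : M.S) : Measurable fun s' => M.p s (π s) s' :=
  hπ.measurable.comp measurable_prodMk_left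

theorem measurable_uncurry : Measurable
    (Function.uncurry fun s s' => ENNReal.ofReal (M.p s (π s) s')) :=
  hπ.measurable.ennreal_ofReal

theorem stepKernel_apply (s : M.S) : M.stepKernel π s =
    (leb M.S).withDensity fun s' => ENNReal.ofReal (M.p s (π s) s') := by
  rw [stepKernel, Kernel.withDensity_apply _ hπ.measurable_uncurry, Kernel.const_apply]

theorem lintegral_stepKernel (s : M.S) {f : M.S → ENNReal} (hf : Measurable f) :
    ∫⁻ s', f s' ∂M.stepKernel π s = ∫⁻ s', ENNReal.ofReal (M.p s (π s) s') * f s' ∂leb M.S := by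
  rw [stepKernel, Kernel.lintegral_withDensity _ hπ.measurable_uncurry _ hf, Kernel.const_apply]

theorem integral_stepKernel (s : M.S) (f : M.S → ℝ) :
    ∫ s', f s' ∂M.stepKernel π s = ∫ s', M.p s (π s) s' * f s' ∂leb M.S := by
  rw [hπ.stepKernel_apply, integral_withDensity_eq_integral_toReal_smul
    (hπ.measurable_density s).ennreal_ofReal (by simp)]
  simp [ENNReal.toReal_ofReal (hπ.nonneg s _)]

omit hπ in
theorem sFinite_law (μ : Measure M.S) [SFinite μ] (t : ℕ) : SFinite (M.law μ π t) := by
  cases t with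
  | zero => assumption
  | succ t => rw [law]; infer_instance

/-- Tonelli: `law` integrates out the old state inside the density, the kernel form outside it. This
opens the way to the kernel calculus. -/
theorem law_succ (μ : Measure M.S) [SFinite μ] (t : ℕ) :
    M.law μ π (t + 1) = (M.law μ π t).bind (M.stepKernel π) := by
  have := sFinite_law (π := π) μ t
  ext B hB
  rw [law, withDensity_apply _ hB, Measure.bind_apply hB (M.stepKernel π).aemeasurable]
  simp_rw [hπ.stepKernel_apply, withDensity_apply _ hB]
  rw [lintegral_lintegral_swap]
  exact (hπ.measurable_uncurry.comp measurable_swap).aemeasurable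

theorem law_eq_bind (μ : Measure M.S) [SFinite μ] (t : ℕ) :
    M.law μ π t = μ.bind (M.iterKernel π t) := by
  induction t with
  | zero =>
    rw [law, iterKernel]
    exact (Measure.id_comp).symm
  | succ t ih =>
    rw [hπ.law_succ, ih, Measure.bind_bind (Kernel.aemeasurable _) (Kernel.aemeasurable _)]
    rfl

theorem law_bind_step (μ : Measure M.S) [SFinite μ] (t : ℕ) :
    M.law μ π (t + 1) = M.law (μ.bind (M.stepKernel π)) π t := by
  have : SFinite (μ.bind (M.stepKernel π)) := by
    have h := hπ.law_succ μ 0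
    have := sFinite_law (π := π) μ (0 + 1)
    rwa [h] at this
  induction t with
  | zero => rw [hπ.law_succ]; rfl
  | succ t ih => rw [hπ.law_succ, ih, hπ.law_succ]

theorem occ_dirac (s : M.S) : M.occ (Measure.dirac s) π = M.occKernel π s := by
  simp only [occ, hπ.law_eq_bind, Measure.dirac_bind (Kernel.measurable _)]
  rfl

/-- Conditioning on the initial state. It reduces expectations from an arbitrary initial law to
totals from single states. -/
theorem occ_eq_bind (μ : Measure M.S) [SFinite μ] :
    M.occ μ π = μ.bind (M.occKernel π) := by
  ext B hB
  rw [Measure.bind_apply hB (Kernel.aemeasurable _)]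
  have : ∀ s, M.occKernel π s B = ∑' t, ENNReal.ofReal (M.γ ^ t) * M.iterKernel π t s B := by
    intro s
    change (Measure.sum fun t => ENNReal.ofReal (M.γ ^ t) • M.iterKernel π t s) B = _
    simp [Measure.sum_apply _ hB]
  simp_rw [this]
  rw [lintegral_tsum fun t => (((M.iterKernel π t).measurable_coe hB).const_mul _).aemeasurable,
    occ, Measure.sum_apply _ hB]
  refine tsum_congr fun t => ?_
  rw [lintegral_const_mul _ ((M.iterKernel π t).measurable_coe hB), hπ.law_eq_bind,
    Measure.smul_apply, Measure.bind_apply hB (Kernel.aemeasurable _), smul_eq_mul]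

omit hπ in
theorem occ_eq_add_sum (μ : Measure M.S) : M.occ μ π = μ + ENNReal.ofReal M.γ •
    Measure.sum fun t => ENNReal.ofReal (M.γ ^ t) • M.law μ π (t + 1) := by
  ext B hB
  rw [occ, Measure.sum_apply _ hB, tsum_eq_zero_add' ENNReal.summable, Measure.add_apply]
  congr 1
  · simp [law]
  rw [Measure.smul_apply, Measure.sum_apply _ hB, smul_eq_mul, ← ENNReal.tsum_mul_left]
  refine tsum_congr fun t => ?_
  simp only [Measure.smul_apply, smul_eq_mul]
  rw [← mul_assoc, ← ENNReal.ofReal_mul M.γ_pos.le, pow_succ']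

/-- Splits off the first transition; on functions this becomes the Bellman equation
`total_eq_add_next_total`. -/
theorem occ_eq_add_occ_bind (μ : Measure M.S) [SFinite μ] :
    M.occ μ π = μ + ENNReal.ofReal M.γ • M.occ (μ.bind (M.stepKernel π)) π := by
  rw [occ_eq_add_sum, occ]
  simp_rw [hπ.law_bind_step]

/-- Splits off the last transition of each term instead; on functions this becomes
`total_eq_add_total_next`, the form that telescopes in the performance difference identity. -/
theorem occ_eq_add_bind_occ (μ : Measure M.S) [SFinite μ] :
    M.occ μ π = μ + ENNReal.ofReal M.γ • (M.occ μ π).bind (M.stepKernel π) := by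
  conv_lhs => rw [occ_eq_add_sum]
  simp_rw [hπ.law_succ, occ]
  rw [Measure.bind_sum _ _ (Kernel.aemeasurable _)]
  simp_rw [Measure.bind_smul]

end Admissible

end MDP

open ProbabilityTheory

/-! ### Weighted bounds for the closed loop -/

/-- `f` is measurable and bounded by `c * W`. -/
structure WeightedBdd {X : Type*} [MeasurableSpace X] (W : X → ℝ) (c : ℝ) (f : X → ℝ) : Prop where
  nonneg : 0 ≤ c
  measurable : Measurable f
  bound : ∀ s, |f s| ≤ c * W s

namespace WeightedBdd

variable {X : Type*} [MeasurableSpace X] {W : X → ℝ} {c d : ℝ} {f g : X → ℝ}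

theorem integrable (hf : WeightedBdd W c f) {μ : Measure X} (hW : Integrable W μ) :
    Integrable f μ :=
  (hW.const_mul c).mono' hf.measurable.aestronglyMeasurable (ae_of_all _ hf.bound)

theorem abs_integral_le (hf : WeightedBdd W c f) {μ : Measure X} (hW : Integrable W μ) :
    |∫ s, f s ∂μ| ≤ c * ∫ s, W s ∂μ := by
  rw [← integral_const_mul, ← Real.norm_eq_abs]
  exact norm_integral_le_of_norm_le (hW.const_mul c) (ae_of_all _ hf.bound)

theorem add (hf : WeightedBdd W c f) (hg : WeightedBdd W d g) :
    WeightedBdd W (c + d) fun s => f s + g s :=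
  ⟨add_nonneg hf.nonneg hg.nonneg, hf.measurable.add hg.measurable, fun s => by
    linarith [abs_add_le (f s) (g s), hf.bound s, hg.bound s, add_mul c d (W s)]⟩

end WeightedBdd

namespace MDP

variable {ns na nθ : ℕ} (M : MDP ns na)

/-- The discounted closed-loop transition contracts the weight `W` by the factor `lam < 1`. -/
structure Drift (π : M.S → E na) (W : M.S → ℝ) (lam : ℝ) : Prop extends M.Admissible π where
  W_measurable : Measurable W
  W_nonneg : ∀ s, 0 ≤ W s
  lam_nonneg : 0 ≤ lam
  lam_lt : lam < 1
  drift : ∀ s, ENNReal.ofReal M.γ *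
      ∫⁻ s', ENNReal.ofReal (M.p s (π s) s') * ENNReal.ofReal (W s') ∂leb M.S ≤
        ENNReal.ofReal (lam * W s)

/-- The discounted expectation of `f` at the next state. -/
def next (π : M.S → E na) (f : M.S → ℝ) (s : M.S) : ℝ :=
  M.γ * ∫ s', M.p s (π s) s' * f s' ∂leb M.S

/-- The expected discounted sum of `f` along the closed loop. -/
def total (π : M.S → E na) (f : M.S → ℝ) (s : M.S) : ℝ :=
  ∫ s', f s' ∂M.occ (Measure.dirac s) π

variable {M} {π : M.S → E na} {W : M.S → ℝ} {lam : ℝ}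

namespace Drift

variable (h : M.Drift π W lam)
include h

theorem one_sub_pos : 0 < 1 - lam := sub_pos.2 h.lam_lt

theorem lintegral_stepKernel_le (s : M.S) : ENNReal.ofReal M.γ *
    ∫⁻ s', ENNReal.ofReal (W s') ∂M.stepKernel π s ≤ ENNReal.ofReal (lam * W s) := by
  rw [h.lintegral_stepKernel s h.W_measurable.ennreal_ofReal]
  exact h.drift s

/-- Iterating the drift inequality gives geometric decay; summing it over `t` produces the factor
`(1 - lam)⁻¹` in all later bounds. -/
theorem lintegral_law_le (μ : Measure M.S) [SFinite μ] (t : ℕ) :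
    ENNReal.ofReal (M.γ ^ t) * ∫⁻ s, ENNReal.ofReal (W s) ∂M.law μ π t ≤
      ENNReal.ofReal (lam ^ t) * ∫⁻ s, ENNReal.ofReal (W s) ∂μ := by
  induction t with
  | zero => simp [law]
  | succ t ih =>
    have hm := h.W_measurable.ennreal_ofReal
    rw [h.law_succ, Measure.lintegral_bind (Kernel.aemeasurable _) hm.aemeasurable, pow_succ,
      ENNReal.ofReal_mul (pow_nonneg M.γ_pos.le t), mul_assoc,
      ← lintegral_const_mul _ (hm.lintegral_kernel)]
    calc _ ≤ ENNReal.ofReal (M.γ ^ t) * ∫⁻ s, ENNReal.ofReal lam * ENNReal.ofReal (W s)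
            ∂M.law μ π t := by
          refine mul_le_mul_right (lintegral_mono fun s => ?_) _
          rw [← ENNReal.ofReal_mul h.lam_nonneg]
          exact h.lintegral_stepKernel_le s
      _ = ENNReal.ofReal lam * (ENNReal.ofReal (M.γ ^ t) *
            ∫⁻ s, ENNReal.ofReal (W s) ∂M.law μ π t) := by
          rw [lintegral_const_mul _ hm]; ring
      _ ≤ ENNReal.ofReal lam * (ENNReal.ofReal (lam ^ t) *
            ∫⁻ s, ENNReal.ofReal (W s) ∂μ) := by gcongr
      _ = _ := by
          rw [← mul_assoc, ← ENNReal.ofReal_mul h.lam_nonneg, pow_succ']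

theorem lintegral_occ_le (μ : Measure M.S) [SFinite μ] :
    ∫⁻ s, ENNReal.ofReal (W s) ∂M.occ μ π ≤
      ENNReal.ofReal (1 - lam)⁻¹ * ∫⁻ s, ENNReal.ofReal (W s) ∂μ := by
  rw [occ, lintegral_sum_measure]
  calc _ ≤ ∑' t : ℕ, ENNReal.ofReal (lam ^ t) * ∫⁻ s, ENNReal.ofReal (W s) ∂μ := by
        refine ENNReal.tsum_le_tsum fun t => ?_
        rw [lintegral_smul_measure]
        exact h.lintegral_law_le μ t
    _ = _ := by
        rw [ENNReal.tsum_mul_right, ← tsum_geometric_of_lt_one h.lam_nonneg h.lam_lt,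
          ENNReal.ofReal_tsum_of_nonneg (fun t => pow_nonneg h.lam_nonneg t)
            (summable_geometric_of_lt_one h.lam_nonneg h.lam_lt)]

theorem integrable_iff {μ : Measure M.S} :
    Integrable W μ ↔ ∫⁻ s, ENNReal.ofReal (W s) ∂μ < ⊤ := by
  rw [Integrable, hasFiniteIntegral_iff_ofReal (ae_of_all _ h.W_nonneg)]
  exact and_iff_right h.W_measurable.aestronglyMeasurable

theorem integrable_occ {μ : Measure M.S} [SFinite μ] (hW : Integrable W μ) :
    Integrable W (M.occ μ π) :=
  h.integrable_iff.2 <| (h.lintegral_occ_le μ).trans_lt <|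
    ENNReal.mul_lt_top ENNReal.ofReal_lt_top (h.integrable_iff.1 hW)

theorem integral_occ_le {μ : Measure M.S} [SFinite μ] (hW : Integrable W μ) :
    ∫ s, W s ∂M.occ μ π ≤ (1 - lam)⁻¹ * ∫ s, W s ∂μ := by
  have hi := inv_nonneg.2 h.one_sub_pos.le
  have h0 : 0 ≤ ∫ s, W s ∂μ := integral_nonneg h.W_nonneg
  rw [← ENNReal.ofReal_le_ofReal_iff (mul_nonneg hi h0), ENNReal.ofReal_mul hi,
    ofReal_integral_eq_lintegral_ofReal hW (ae_of_all _ h.W_nonneg),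
    ofReal_integral_eq_lintegral_ofReal (h.integrable_occ hW) (ae_of_all _ h.W_nonneg)]
  exact h.lintegral_occ_le μ

theorem abs_integral_occ_le {μ : Measure M.S} [SFinite μ] (hW : Integrable W μ) {c : ℝ}
    {f : M.S → ℝ} (hf : WeightedBdd W c f) :
    |∫ s, f s ∂M.occ μ π| ≤ c * (1 - lam)⁻¹ * ∫ s, W s ∂μ := by
  calc |∫ s, f s ∂M.occ μ π| ≤ c * ∫ s, W s ∂M.occ μ π :=
        hf.abs_integral_le (h.integrable_occ hW)
    _ ≤ c * ((1 - lam)⁻¹ * ∫ s, W s ∂μ) :=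
        mul_le_mul_of_nonneg_left (h.integral_occ_le hW) hf.nonneg
    _ = _ := by ring

theorem integrable_dirac (s : M.S) : Integrable W (Measure.dirac s) :=
  h.integrable_iff.2 <| by
    rw [lintegral_dirac' _ h.W_measurable.ennreal_ofReal]; exact ENNReal.ofReal_lt_top

theorem integrable_stepKernel (s : M.S) : Integrable W (M.stepKernel π s) := by
  rw [h.integrable_iff]
  have h1 := (h.lintegral_stepKernel_le s).trans_lt ENNReal.ofReal_lt_top
  by_contra hc
  -- Since `γ > 0`, an infinite integral would stay infinite after discounting, against the finite
  -- drift bound.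
  rw [not_lt_top_iff.1 hc, ENNReal.mul_top (by simpa using M.γ_pos)] at h1
  exact lt_irrefl _ h1

theorem integrable_density_mul {c : ℝ} {f : M.S → ℝ} (hf : WeightedBdd W c f) (s : M.S) :
    Integrable (fun s' => M.p s (π s) s' * f s') (leb M.S) := by
  have := hf.integrable (h.integrable_stepKernel s)
  rw [h.stepKernel_apply, integrable_withDensity_iff_integrable_smul'
    (h.measurable_density s).ennreal_ofReal (by simp)] at this
  simpa [ENNReal.toReal_ofReal (h.nonneg s _)] using this

theorem integral_stepKernel_le (s : M.S) :
    M.γ * ∫ s', W s' ∂M.stepKernel π s ≤ lam * W s := by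
  have h1 := h.lintegral_stepKernel_le s
  rw [← ofReal_integral_eq_lintegral_ofReal (h.integrable_stepKernel s)
    (ae_of_all _ h.W_nonneg), ← ENNReal.ofReal_mul M.γ_pos.le,
    ENNReal.ofReal_le_ofReal_iff (mul_nonneg h.lam_nonneg (h.W_nonneg s))] at h1
  exact h1

theorem next_eq (f : M.S → ℝ) (s : M.S) : M.next π f s = M.γ * ∫ s', f s' ∂M.stepKernel π s := by
  rw [next, h.integral_stepKernel]

theorem weightedBdd_next {c : ℝ} {f : M.S → ℝ} (hf : WeightedBdd W c f) :
    WeightedBdd W c (M.next π f) := by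
  refine ⟨hf.nonneg, ?_, fun s => ?_⟩
  · have : M.next π f = fun s => M.γ * ∫ s', f s' ∂M.stepKernel π s := funext (h.next_eq f)
    rw [this]
    exact (hf.measurable.stronglyMeasurable.integral_kernel.measurable).const_mul _
  · rw [h.next_eq, abs_mul, abs_of_pos M.γ_pos]
    calc M.γ * |∫ s', f s' ∂M.stepKernel π s| ≤ M.γ * (c * ∫ s', W s' ∂M.stepKernel π s) :=
          mul_le_mul_of_nonneg_left (hf.abs_integral_le (h.integrable_stepKernel s)) M.γ_pos.le
      _ = c * (M.γ * ∫ s', W s' ∂M.stepKernel π s) := by ring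
      _ ≤ c * (lam * W s) := mul_le_mul_of_nonneg_left (h.integral_stepKernel_le s) hf.nonneg
      _ ≤ c * (1 * W s) := mul_le_mul_of_nonneg_left
          (mul_le_mul_of_nonneg_right h.lam_lt.le (h.W_nonneg s)) hf.nonneg
      _ = c * W s := by rw [one_mul]

theorem total_eq (f : M.S → ℝ) (s : M.S) : M.total π f s = ∫ s', f s' ∂M.occKernel π s := by
  rw [total, h.occ_dirac]

theorem weightedBdd_total {c : ℝ} {f : M.S → ℝ} (hf : WeightedBdd W c f) :
    WeightedBdd W (c * (1 - lam)⁻¹) (M.total π f) := by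
  refine ⟨mul_nonneg hf.nonneg (inv_nonneg.2 h.one_sub_pos.le), ?_, fun s => ?_⟩
  · rw [show M.total π f = fun s => ∫ s', f s' ∂M.occKernel π s from funext (h.total_eq f)]
    exact hf.measurable.stronglyMeasurable.integral_kernel.measurable
  · refine (h.abs_integral_occ_le (h.integrable_dirac s) hf).trans_eq ?_
    rw [integral_dirac' _ _ h.W_measurable.stronglyMeasurable]

theorem integral_occ_eq {μ : Measure M.S} [SFinite μ] (hW : Integrable W μ) {c : ℝ}
    {f : M.S → ℝ} (hf : WeightedBdd W c f) :
    ∫ s, f s ∂M.occ μ π = ∫ s, M.total π f s ∂μ := by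
  have hi := hf.integrable (h.integrable_occ hW)
  rw [h.occ_eq_bind] at hi ⊢
  rw [integral_bind_kernel _ _ hi]
  simp_rw [h.total_eq]

theorem total_eq_add_next_total {c : ℝ} {f : M.S → ℝ} (hf : WeightedBdd W c f) (s : M.S) :
    M.total π f s = f s + M.next π (M.total π f) s := by
  have hi := hf.integrable (h.integrable_occ (h.integrable_dirac s))
  have hκ : (Measure.dirac s).bind (M.stepKernel π) = M.stepKernel π s :=
    Measure.dirac_bind (Kernel.measurable _) s
  have hs : SFinite (M.stepKernel π s) := by rw [h.stepKernel_apply]; infer_instance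
  have ho := h.occ_eq_add_occ_bind (Measure.dirac s)
  rw [hκ] at ho
  have hi2 := hf.integrable (h.integrable_occ (h.integrable_stepKernel s))
  rw [total, ho, integral_add_measure (hf.integrable (h.integrable_dirac s))
    (hi2.smul_measure ENNReal.ofReal_ne_top), integral_dirac' _ _
      hf.measurable.stronglyMeasurable, integral_smul_measure,
    ENNReal.toReal_ofReal M.γ_pos.le, h.integral_occ_eq (h.integrable_stepKernel s) hf,
    h.next_eq, smul_eq_mul]

theorem total_eq_add_total_next {c : ℝ} {f : M.S → ℝ} (hf : WeightedBdd W c f) (s : M.S) :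
    M.total π f s = f s + M.total π (M.next π f) s := by
  have ho := h.occ_eq_add_bind_occ (Measure.dirac s)
  have hi := hf.integrable (h.integrable_occ (h.integrable_dirac s))
  have hb : Integrable f ((M.occ (Measure.dirac s) π).bind (M.stepKernel π)) := by
    rw [ho] at hi
    have := hi.right_of_add_measure
    rwa [integrable_smul_measure (by simpa using M.γ_pos) ENNReal.ofReal_ne_top] at this
  conv_lhs => rw [total, ho]
  rw [integral_add_measure (hf.integrable (h.integrable_dirac s))
    (hb.smul_measure ENNReal.ofReal_ne_top), integral_dirac' _ _
      hf.measurable.stronglyMeasurable, integral_smul_measure,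
    ENNReal.toReal_ofReal M.γ_pos.le, integral_bind_kernel _ _ hb, smul_eq_mul,
    ← integral_const_mul, total]
  simp_rw [h.next_eq]

theorem integrable_total {c : ℝ} {f : M.S → ℝ} (hf : WeightedBdd W c f) (s : M.S) :
    Integrable f (M.occ (Measure.dirac s) π) :=
  hf.integrable (h.integrable_occ (h.integrable_dirac s))

theorem total_sub {c d : ℝ} {f g : M.S → ℝ} (hf : WeightedBdd W c f) (hg : WeightedBdd W d g)
    (s : M.S) : M.total π (fun s => f s - g s) s = M.total π f s - M.total π g s :=
  integral_sub (h.integrable_total hf s) (h.integrable_total hg s)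

/-- Comparison of the total of `f` with an arbitrary weighted-bounded function `g`. -/
theorem total_sub_eq_total {c d : ℝ} {f g : M.S → ℝ} (hf : WeightedBdd W c f)
    (hg : WeightedBdd W d g) (s : M.S) :
    -- With `T` the total and `P` the discounted transition, `T g = g + T P g`, so `T (f + P g - g)
    -- = T f - g`.
    M.total π f s - g s = M.total π (fun s => f s + M.next π g s - g s) s := by
  rw [h.total_sub (hf.add (h.weightedBdd_next hg)) hg, h.total_eq_add_total_next hg]
  have : M.total π (fun s => f s + M.next π g s) s = M.total π f s + M.total π (M.next π g) s :=
    integral_add (h.integrable_total hf s) (h.integrable_total (h.weightedBdd_next hg) s)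
  rw [this]
  ring

/-- Optimality only compares with policies of finite cost; this admits the nearby policies of the
family as competitors. -/
theorem finiteCost {c : ℝ} (hf : WeightedBdd W c fun s => M.ℓ s (π s)) (s : M.S) :
    M.FiniteCost (Measure.dirac s) π :=
  (h.integrable_total hf s).2

/-- Two closed loops with nearby transitions have nearby discounted totals. -/
theorem abs_total_sub_total_le {π' : M.S → E na} (h' : M.Drift π' W lam) {ε : ℝ} (hε : 0 ≤ ε)
    (hclose : ∀ (d : ℝ) (g : M.S → ℝ), WeightedBdd W d g →
      ∀ s, |M.next π g s - M.next π' g s| ≤ ε * d * W s)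
    {c : ℝ} {f : M.S → ℝ} (hf : WeightedBdd W c f) :
    WeightedBdd W (ε * (c * (1 - lam)⁻¹) * (1 - lam)⁻¹)
      fun s => M.total π f s - M.total π' f s := by
  have hg := h'.weightedBdd_total hf
  have hd : WeightedBdd W (ε * (c * (1 - lam)⁻¹))
      (fun s => M.next π (M.total π' f) s - M.next π' (M.total π' f) s) :=
    ⟨mul_nonneg hε hg.nonneg,
      (h.weightedBdd_next hg).measurable.sub (h'.weightedBdd_next hg).measurable,
      hclose _ _ hg⟩
  -- A resolvent identity: `T f - T' f = T (P - P') T' f`, from the comparison lemma with `g = T'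
  -- f`.
  have : (fun s => M.total π f s - M.total π' f s) =
      M.total π fun s => M.next π (M.total π' f) s - M.next π' (M.total π' f) s := by
    funext s
    rw [h.total_sub_eq_total hf hg]
    congr 1
    funext s
    rw [h'.total_eq_add_next_total hf]
    ring
  rw [this]
  exact h.weightedBdd_total hd

end Drift

end MDP

/-! ### Second derivatives of compositions and of parametric integrals -/

section calculus

variable {F G : Type*} [NormedAddCommGroup F] [NormedSpace ℝ F]
  [NormedAddCommGroup G] [NormedSpace ℝ G]

/-- The second derivative of `f ∘ g` in terms of `c = Df`, `c₂ = D²f`, `d = Dg`, `d₂ = D²g`. -/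
def secondComp (c : F →L[ℝ] ℝ) (c₂ : F →L[ℝ] F →L[ℝ] ℝ) (d : G →L[ℝ] F)
    (d₂ : G →L[ℝ] G →L[ℝ] F) : G →L[ℝ] G →L[ℝ] ℝ :=
  (ContinuousLinearMap.compL ℝ G F ℝ c).comp d₂ +
    ((ContinuousLinearMap.compL ℝ G F ℝ).flip d).comp (c₂.comp d)

theorem secondComp_apply (c : F →L[ℝ] ℝ) (c₂ : F →L[ℝ] F →L[ℝ] ℝ) (d : G →L[ℝ] F)
    (d₂ : G →L[ℝ] G →L[ℝ] F) (u v : G) :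
    secondComp c c₂ d d₂ u v = c (d₂ u v) + c₂ (d u) (d v) := rfl

theorem Continuous.secondComp {X : Type*} [TopologicalSpace X] {c : X → F →L[ℝ] ℝ}
    {c₂ : X → F →L[ℝ] F →L[ℝ] ℝ} {d : X → G →L[ℝ] F} {d₂ : X → G →L[ℝ] G →L[ℝ] F}
    (hc : Continuous c) (hc₂ : Continuous c₂) (hd : Continuous d) (hd₂ : Continuous d₂) :
    Continuous fun x => secondComp (c x) (c₂ x) (d x) (d₂ x) := by
  unfold QNPolicy.secondComp
  exact (((ContinuousLinearMap.compL ℝ G F ℝ).continuous.comp hc).clm_comp hd₂).add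
    (((ContinuousLinearMap.compL ℝ G F ℝ).flip.continuous.comp hd).clm_comp (hc₂.clm_comp hd))

theorem fderiv_comp_eventuallyEq {f : F → ℝ} {g : G → F} {x : G}
    (hf : ∀ᶠ y in 𝓝 (g x), DifferentiableAt ℝ f y) (hg : Differentiable ℝ g) :
    fderiv ℝ (fun z => f (g z)) =ᶠ[𝓝 x] fun z => (fderiv ℝ f (g z)).comp (fderiv ℝ g z) := by
  filter_upwards [hg.continuous.continuousAt.eventually hf] with z hz
  exact fderiv_comp z hz (hg z)

theorem hasFDerivAt_fderiv_comp {f : F → ℝ} {g : G → F} {x : G}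
    (hf : ∀ᶠ y in 𝓝 (g x), DifferentiableAt ℝ f y) (hf₂ : DifferentiableAt ℝ (fderiv ℝ f) (g x))
    (hg : Differentiable ℝ g) (hg₂ : DifferentiableAt ℝ (fderiv ℝ g) x) :
    HasFDerivAt (fderiv ℝ fun z => f (g z)) (secondComp (fderiv ℝ f (g x))
      (fderiv ℝ (fderiv ℝ f) (g x)) (fderiv ℝ g x) (fderiv ℝ (fderiv ℝ g) x)) x := by
  refine HasFDerivAt.congr_of_eventuallyEq ?_ (fderiv_comp_eventuallyEq hf hg)
  exact (hf₂.hasFDerivAt.comp x (hg x).hasFDerivAt).clm_comp hg₂.hasFDerivAt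

/-- A family `f y` of twice continuously differentiable functions on the open set `A`, composed with
a twice continuously differentiable family of maps `g · y` into `A`; all derivatives are jointly
continuous. -/
structure SmoothFamily {Y : Type*} [TopologicalSpace Y] (A : Set F) (f : Y → F → ℝ)
    (g : G → Y → F) : Prop where
  isOpen : IsOpen A
  mapsTo : ∀ x y, g x y ∈ A
  f_cont : ContinuousOn (fun x : Y × F => f x.1 x.2) {x | x.2 ∈ A}
  f_diff : ∀ y, DifferentiableOn ℝ (f y) A
  df_cont : ContinuousOn (fun x : Y × F => fderiv ℝ (f x.1) x.2) {x | x.2 ∈ A}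
  f_diff₂ : ∀ y, DifferentiableOn ℝ (fderiv ℝ (f y)) A
  ddf_cont : ContinuousOn (fun x : Y × F => fderiv ℝ (fderiv ℝ (f x.1)) x.2) {x | x.2 ∈ A}
  g_cont : Continuous fun x : G × Y => g x.1 x.2
  g_diff : ∀ y, Differentiable ℝ fun x => g x y
  dg_cont : Continuous fun x : G × Y => fderiv ℝ (fun z => g z x.2) x.1
  g_diff₂ : ∀ y, Differentiable ℝ (fderiv ℝ fun x => g x y)
  ddg_cont : Continuous fun x : G × Y => fderiv ℝ (fderiv ℝ fun z => g z x.2) x.1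

namespace SmoothFamily

variable {Y : Type*} [TopologicalSpace Y] {A : Set F} {f : Y → F → ℝ} {g : G → Y → F}
  (h : SmoothFamily A f g)
include h

theorem continuous_comp {Z : Type*} [TopologicalSpace Z] {k : Y → F → Z}
    (hk : ContinuousOn (fun x : Y × F => k x.1 x.2) {x | x.2 ∈ A}) :
    Continuous fun x : G × Y => k x.2 (g x.1 x.2) :=
  hk.comp_continuous (continuous_snd.prodMk h.g_cont) fun x => h.mapsTo x.1 x.2

theorem eventually_diff (y : Y) {a : F} (ha : a ∈ A) : ∀ᶠ b in 𝓝 a, DifferentiableAt ℝ (f y) b := by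
  filter_upwards [h.isOpen.mem_nhds ha] with b hb
  exact (h.f_diff y).differentiableAt (h.isOpen.mem_nhds hb)

theorem diff (y : Y) : Differentiable ℝ fun x => f y (g x y) := fun x =>
  (h.eventually_diff y (h.mapsTo x y)).self_of_nhds.comp x (h.g_diff y x)

theorem fderiv_eq (y : Y) (x : G) : fderiv ℝ (fun z => f y (g z y)) x =
    (fderiv ℝ (f y) (g x y)).comp (fderiv ℝ (fun z => g z y) x) :=
  (fderiv_comp_eventuallyEq (g := fun z => g z y) (h.eventually_diff y (h.mapsTo x y))
    (h.g_diff y)).self_of_nhds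

theorem hasFDerivAt_fderiv (y : Y) (x : G) : HasFDerivAt (fderiv ℝ fun z => f y (g z y))
    (secondComp (fderiv ℝ (f y) (g x y)) (fderiv ℝ (fderiv ℝ (f y)) (g x y))
      (fderiv ℝ (fun z => g z y) x) (fderiv ℝ (fderiv ℝ fun z => g z y) x)) x :=
  hasFDerivAt_fderiv_comp (h.eventually_diff y (h.mapsTo x y))
    ((h.f_diff₂ y).differentiableAt (h.isOpen.mem_nhds (h.mapsTo x y))) (h.g_diff y)
    (h.g_diff₂ y x)

theorem diff₂ (y : Y) : Differentiable ℝ (fderiv ℝ fun x => f y (g x y)) := fun x =>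
  (h.hasFDerivAt_fderiv y x).differentiableAt

theorem continuous : Continuous fun x : G × Y => f x.2 (g x.1 x.2) := h.continuous_comp h.f_cont

theorem continuous_fderiv :
    Continuous fun x : G × Y => fderiv ℝ (fun z => f x.2 (g z x.2)) x.1 := by
  simp_rw [h.fderiv_eq]
  exact (h.continuous_comp (k := fun y a => fderiv ℝ (f y) a) h.df_cont).clm_comp h.dg_cont

theorem continuous_fderiv₂ :
    Continuous fun x : G × Y => fderiv ℝ (fderiv ℝ fun z => f x.2 (g z x.2)) x.1 := by
  simp_rw [(h.hasFDerivAt_fderiv _ _).fderiv]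
  exact Continuous.secondComp (h.continuous_comp (k := fun y a => fderiv ℝ (f y) a) h.df_cont)
    (h.continuous_comp (k := fun y a => fderiv ℝ (fderiv ℝ (f y)) a) h.ddf_cont)
    h.dg_cont h.ddg_cont

end SmoothFamily

/-- A function with vanishing derivative at the centre of a ball and bounded second derivative
grows at most quadratically. -/
theorem abs_sub_le_of_fderiv_eq_zero {f : G → ℝ} {x₀ : G} {r K : ℝ}
    (hf : ∀ x ∈ Metric.ball x₀ r, DifferentiableAt ℝ f x)
    (hf₂ : ∀ x ∈ Metric.ball x₀ r, DifferentiableAt ℝ (fderiv ℝ f) x)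
    (hK : ∀ x ∈ Metric.ball x₀ r, ‖fderiv ℝ (fderiv ℝ f) x‖ ≤ K)
    (h0 : fderiv ℝ f x₀ = 0) {x : G} (hx : x ∈ Metric.ball x₀ r) :
    |f x - f x₀| ≤ K * ‖x - x₀‖ ^ 2 := by
  -- The mean value inequality is used twice, first for the derivative and then for the function on
  -- the segment; this yields `K` rather than the sharp `K / 2`, which is enough.
  have hr : 0 < r := dist_nonneg.trans_lt hx
  have hx₀ : x₀ ∈ Metric.ball x₀ r := Metric.mem_ball_self hr
  have hK0 : 0 ≤ K := (norm_nonneg (fderiv ℝ (fderiv ℝ f) x₀)).trans (hK x₀ hx₀)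
  have h1 : ∀ y ∈ Metric.ball x₀ r, ‖fderiv ℝ f y‖ ≤ K * ‖y - x₀‖ := fun y hy => by
    simpa [h0] using (convex_ball x₀ r).norm_image_sub_le_of_norm_fderiv_le hf₂ hK hx₀ hy
  have hsub : segment ℝ x₀ x ⊆ Metric.ball x₀ r := (convex_ball x₀ r).segment_subset hx₀ hx
  have h2 : ∀ y ∈ segment ℝ x₀ x, ‖fderiv ℝ f y‖ ≤ K * ‖x - x₀‖ := fun y hy => by
    refine (h1 y (hsub hy)).trans (mul_le_mul_of_nonneg_left ?_ hK0)
    have : y ∈ Metric.closedBall x₀ ‖x - x₀‖ :=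
      (convex_closedBall x₀ _).segment_subset (Metric.mem_closedBall_self (norm_nonneg _))
        (by rw [Metric.mem_closedBall, dist_eq_norm]) hy
    rwa [Metric.mem_closedBall, dist_eq_norm] at this
  have := (convex_segment x₀ x).norm_image_sub_le_of_norm_fderiv_le
    (fun y hy => hf y (hsub hy)) h2 (left_mem_segment ℝ x₀ x) (right_mem_segment ℝ x₀ x)
  rw [← Real.norm_eq_abs]
  exact this.trans_eq (by ring)

theorem tendsto_slope_line {f : G → ℝ} {x : G} (hf : DifferentiableAt ℝ f x) (v : G) :
    Tendsto (fun t : ℝ => t⁻¹ * (f (x + t • v) - f x)) (𝓝[≠] 0) (𝓝 (fderiv ℝ f x v)) := by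
  have := (hf.hasFDerivAt.hasLineDerivAt v)
  simpa using hasDerivAt_iff_tendsto_slope_zero.1 this

/-- Second-order Taylor expansion along a line at a critical point. -/
theorem tendsto_second_slope_line {f : G → ℝ} {x : G} (hf : ∀ᶠ y in 𝓝 x, DifferentiableAt ℝ f y)
    (hf₂ : DifferentiableAt ℝ (fderiv ℝ f) x) (h0 : fderiv ℝ f x = 0) (v : G) :
    Tendsto (fun t : ℝ => (f (x + t • v) - f x) / t ^ 2) (𝓝[≠] 0)
      (𝓝 (fderiv ℝ (fderiv ℝ f) x v v / 2)) := by
  have hl : Tendsto (fun t : ℝ => x + t • v) (𝓝 0) (𝓝 x) := by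
    have : Continuous fun t : ℝ => x + t • v := by fun_prop
    simpa using this.tendsto 0
  have hd : ∀ᶠ t : ℝ in 𝓝[≠] 0, HasDerivAt (fun t : ℝ => f (x + t • v) - f x)
      (fderiv ℝ f (x + t • v) v) t := by
    filter_upwards [nhdsWithin_le_nhds (hl.eventually hf)] with t ht
    have h1 : HasDerivAt (fun t : ℝ => x + t • v) v t := by
      simpa using ((hasDerivAt_id t).smul_const v).const_add x
    exact (ht.hasFDerivAt.comp_hasDerivAt t h1).sub_const _
  have hd2 : ∀ᶠ t : ℝ in 𝓝[≠] 0, HasDerivAt (fun t : ℝ => t ^ 2) (2 * t) t :=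
    Eventually.of_forall fun t => by simpa using hasDerivAt_pow 2 t
  -- L'Hôpital reduces the claim to the difference quotient of the first derivative, so the second
  -- derivative is needed only at `x` itself.
  refine HasDerivAt.lhopital_zero_nhdsNE hd hd2 ?_ ?_ ?_ ?_
  · filter_upwards [self_mem_nhdsWithin] with t ht
    exact mul_ne_zero two_ne_zero ht
  · have := (hf.self_of_nhds.continuousAt.tendsto.comp hl).sub_const (f x)
    rw [sub_self] at this
    exact this.mono_left nhdsWithin_le_nhds
  · have : Continuous fun t : ℝ => t ^ 2 := by fun_prop
    simpa using (this.tendsto 0).mono_left nhdsWithin_le_nhds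
  · have h1 := hasDerivAt_iff_tendsto_slope_zero.1 (hf₂.hasFDerivAt.hasLineDerivAt v)
    have h2 := (((ContinuousLinearMap.apply ℝ ℝ v).continuous.tendsto _).comp h1).div_const 2
    refine (h2.congr fun t => ?_)
    simp [h0]
    ring

end calculus

/-! ### Differentiating twice under the integral sign. -/

section paramIntegral

theorem norm_smul_le_mul_abs {V : Type*} [NormedAddCommGroup V] [NormedSpace ℝ V] {T : V} {b c : ℝ}
    (h : ‖T‖ ≤ b) : ‖c • T‖ ≤ b * |c| := by
  rw [norm_smul, mul_comm, Real.norm_eq_abs]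
  exact mul_le_mul_of_nonneg_right h (abs_nonneg _)

variable {G X : Type*} [NormedAddCommGroup G] [NormedSpace ℝ G] [MeasurableSpace X]
  {ν : Measure X} {q : G → X → ℝ} {w g : X → ℝ} {B : Set G}

/-- A density `q x` depending on a parameter `x` in a convex open set `B`, twice differentiable with
derivatives dominated by `g`, where `g * w` is integrable. -/
structure DominatedDensity (ν : Measure X) (q : G → X → ℝ) (w g : X → ℝ) (B : Set G) : Prop where
  isOpen : IsOpen B
  convex : Convex ℝ B
  diff : ∀ x ∈ B, ∀ y, DifferentiableAt ℝ (fun z => q z y) x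
  diff₂ : ∀ x ∈ B, ∀ y, DifferentiableAt ℝ (fderiv ℝ fun z => q z y) x
  meas : ∀ x ∈ B, AEStronglyMeasurable (q x) ν
  meas₁ : ∀ x ∈ B, AEStronglyMeasurable (fun y => fderiv ℝ (fun z => q z y) x) ν
  meas₂ : ∀ x ∈ B, AEStronglyMeasurable (fun y => fderiv ℝ (fderiv ℝ fun z => q z y) x) ν
  meas_w : AEStronglyMeasurable w ν
  bound₁ : ∀ x ∈ B, ∀ y, ‖fderiv ℝ (fun z => q z y) x‖ ≤ g y
  bound₂ : ∀ x ∈ B, ∀ y, ‖fderiv ℝ (fderiv ℝ fun z => q z y) x‖ ≤ g y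
  integrable_bound : Integrable (fun y => g y * |w y|) ν
  integrable : ∃ x ∈ B, Integrable (fun y => q x y * w y) ν

namespace DominatedDensity

variable (h : DominatedDensity ν q w g B)
include h

/-- Integrability spreads from one parameter to all of `B`, because by the mean value inequality the
density changes by at most `g` times the distance. -/
theorem integrable_of_mem {x : G} (hx : x ∈ B) : Integrable (fun y => q x y * w y) ν := by
  obtain ⟨x₀, hx₀, hi⟩ := h.integrable
  have hd : Integrable (fun y => (q x y - q x₀ y) * w y) ν := by
    refine (h.integrable_bound.const_mul ‖x - x₀‖).mono'
      (((h.meas x hx).sub (h.meas x₀ hx₀)).mul h.meas_w) (ae_of_all _ fun y => ?_)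
    have := h.convex.norm_image_sub_le_of_norm_fderiv_le (fun z hz => h.diff z hz y)
      (fun z hz => h.bound₁ z hz y) hx₀ hx
    rw [norm_mul, Real.norm_eq_abs (w y)]
    calc _ ≤ g y * ‖x - x₀‖ * |w y| := mul_le_mul_of_nonneg_right this (abs_nonneg _)
      _ = _ := by ring
  refine (hi.add hd).congr (ae_of_all _ fun y => ?_)
  simp only [Pi.add_apply]
  ring

theorem hasFDerivAt {x : G} (hx : x ∈ B) : HasFDerivAt (fun x => ∫ y, q x y * w y ∂ν)
    (∫ y, w y • fderiv ℝ (fun z => q z y) x ∂ν) x := by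
  refine hasFDerivAt_integral_of_dominated_of_fderiv_le (h.isOpen.mem_nhds hx)
    (F' := fun x y => w y • fderiv ℝ (fun z => q z y) x) ?_ (h.integrable_of_mem hx)
    (h.meas_w.smul (h.meas₁ x hx)) ?_ h.integrable_bound ?_
  · filter_upwards [h.isOpen.mem_nhds hx] with z hz
    exact (h.meas z hz).mul h.meas_w
  · refine ae_of_all _ fun y z hz => ?_
    exact norm_smul_le_mul_abs (h.bound₁ z hz y)
  · exact ae_of_all _ fun y z hz => (h.diff z hz y).hasFDerivAt.mul_const (w y)

theorem hasFDerivAt_integral_fderiv {x : G} (hx : x ∈ B) :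
    HasFDerivAt (fun x => ∫ y, w y • fderiv ℝ (fun z => q z y) x ∂ν)
      (∫ y, w y • fderiv ℝ (fderiv ℝ fun z => q z y) x ∂ν) x := by
  have hb (y : X) (z : G) (hz : z ∈ B) : ‖w y • fderiv ℝ (fun z => q z y) z‖ ≤ g y * |w y| := by
    exact norm_smul_le_mul_abs (h.bound₁ z hz y)
  refine hasFDerivAt_integral_of_dominated_of_fderiv_le (h.isOpen.mem_nhds hx)
    (F' := fun x y => w y • fderiv ℝ (fderiv ℝ fun z => q z y) x) ?_ ?_
    (h.meas_w.smul (h.meas₂ x hx)) ?_ h.integrable_bound ?_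
  · filter_upwards [h.isOpen.mem_nhds hx] with z hz
    exact h.meas_w.smul (h.meas₁ z hz)
  · exact h.integrable_bound.mono' (h.meas_w.smul (h.meas₁ x hx))
      (ae_of_all _ fun y => hb y x hx)
  · refine ae_of_all _ fun y z hz => ?_
    exact norm_smul_le_mul_abs (V := G →L[ℝ] G →L[ℝ] ℝ) (h.bound₂ z hz y)
  · exact ae_of_all _ fun y z hz => (h.diff₂ z hz y).hasFDerivAt.const_smul (w y)

theorem hasFDerivAt_fderiv {x : G} (hx : x ∈ B) :
    HasFDerivAt (fderiv ℝ fun x => ∫ y, q x y * w y ∂ν)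
      (∫ y, w y • fderiv ℝ (fderiv ℝ fun z => q z y) x ∂ν) x := by
  refine (h.hasFDerivAt_integral_fderiv hx).congr_of_eventuallyEq ?_
  filter_upwards [h.isOpen.mem_nhds hx] with z hz
  exact (h.hasFDerivAt hz).fderiv

theorem norm_fderiv_le {x : G} (hx : x ∈ B) :
    ‖fderiv ℝ (fun x => ∫ y, q x y * w y ∂ν) x‖ ≤ ∫ y, g y * |w y| ∂ν := by
  rw [(h.hasFDerivAt hx).fderiv]
  refine norm_integral_le_of_norm_le h.integrable_bound (ae_of_all _ fun y => ?_)
  exact norm_smul_le_mul_abs (h.bound₁ x hx y)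

theorem norm_fderiv₂_le {x : G} (hx : x ∈ B) :
    ‖fderiv ℝ (fderiv ℝ fun x => ∫ y, q x y * w y ∂ν) x‖ ≤ ∫ y, g y * |w y| ∂ν := by
  rw [(h.hasFDerivAt_fderiv hx).fderiv]
  refine norm_integral_le_of_norm_le h.integrable_bound (ae_of_all _ fun y => ?_)
  exact norm_smul_le_mul_abs (V := G →L[ℝ] G →L[ℝ] ℝ) (h.bound₂ x hx y)

end DominatedDensity

end paramIntegral

/-! ### The one-step lookahead near the reference parameter -/

theorem integrable_mul_of_lintegral_lt_top {X : Type*} [MeasurableSpace X] {ν : Measure X}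
    {g W : X → ℝ} (hg : Measurable g) (hW : Measurable W) (hg0 : ∀ x, 0 ≤ g x)
    (hW0 : ∀ x, 0 ≤ W x)
    (h : ∫⁻ x, ENNReal.ofReal (g x) * ENNReal.ofReal (W x) ∂ν < ⊤) :
    Integrable (fun x => g x * W x) ν := by
  refine ⟨(hg.mul hW).aestronglyMeasurable, ?_⟩
  rw [hasFiniteIntegral_iff_ofReal (ae_of_all _ fun x => mul_nonneg (hg0 x) (hW0 x))]
  simpa only [ENNReal.ofReal_mul (hg0 _)] using h

theorem integral_mul_le_of_lintegral_le {X : Type*} [MeasurableSpace X] {ν : Measure X}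
    {g W : X → ℝ} (hg : Measurable g) (hW : Measurable W) (hg0 : ∀ x, 0 ≤ g x)
    (hW0 : ∀ x, 0 ≤ W x) {c : ℝ} (hc : 0 ≤ c)
    (h : ∫⁻ x, ENNReal.ofReal (g x) * ENNReal.ofReal (W x) ∂ν ≤ ENNReal.ofReal c) :
    ∫ x, g x * W x ∂ν ≤ c := by
  have hi := integrable_mul_of_lintegral_lt_top hg hW hg0 hW0 (h.trans_lt ENNReal.ofReal_lt_top)
  rw [← ENNReal.ofReal_le_ofReal_iff hc,
    ofReal_integral_eq_lintegral_ofReal hi (ae_of_all _ fun x => mul_nonneg (hg0 x) (hW0 x))]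
  simpa only [ENNReal.ofReal_mul (hg0 _)] using h

theorem WeightedBdd.mul_abs_le {X : Type*} [MeasurableSpace X] {W : X → ℝ} {c : ℝ} {f : X → ℝ}
    (hf : WeightedBdd W c f) {b : ℝ} (hb : 0 ≤ b) (x : X) : b * |f x| ≤ c * (b * W x) :=
  (mul_le_mul_of_nonneg_left (hf.bound x) hb).trans_eq (by ring)

theorem WeightedBdd.integrable_mul_abs {X : Type*} [MeasurableSpace X] {ν : Measure X}
    {W : X → ℝ} {c : ℝ} {f g : X → ℝ} (hf : WeightedBdd W c f) (hg : Measurable g)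
    (hg0 : ∀ x, 0 ≤ g x) (h : Integrable (fun x => g x * W x) ν) :
    Integrable (fun x => g x * |f x|) ν := by
  refine (h.const_mul c).mono' (hg.mul hf.measurable.norm).aestronglyMeasurable
    (ae_of_all _ fun x => ?_)
  rw [Real.norm_eq_abs, abs_of_nonneg (mul_nonneg (hg0 x) (abs_nonneg _))]
  exact hf.mul_abs_le (hg0 x) x

theorem norm_add_smul_le {V : Type*} [NormedAddCommGroup V] [NormedSpace ℝ V] {x y : V}
    {a b c : ℝ} (hx : ‖x‖ ≤ a) (hy : ‖y‖ ≤ b) (hc : 0 ≤ c) (hc1 : c ≤ 1) : ‖x + c • y‖ ≤ a + b := by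
  refine (norm_add_le _ _).trans (add_le_add hx ?_)
  rw [norm_smul, Real.norm_of_nonneg hc]
  exact (mul_le_of_le_one_left (norm_nonneg y) hc1).trans hy

theorem clm_apply_eq_sum {n : ℕ} (L : E n →L[ℝ] ℝ) (x : E n) :
    L x = ∑ k, x k * L (EuclideanSpace.single k 1) := by
  conv_lhs => rw [← (EuclideanSpace.basisFun (Fin n) ℝ).sum_repr x]
  simp

theorem clm_apply₂_eq_sum {n : ℕ} (L : E n →L[ℝ] E n →L[ℝ] ℝ) (x y : E n) :
    L x y = ∑ k, ∑ l, x k * y l * L (EuclideanSpace.single k 1) (EuclideanSpace.single l 1) := by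
  have : L x y = (L.flip y) x := rfl
  rw [this, clm_apply_eq_sum (L.flip y)]
  refine Finset.sum_congr rfl fun k _ => ?_
  rw [ContinuousLinearMap.flip_apply, clm_apply_eq_sum _ y, Finset.mul_sum]
  exact Finset.sum_congr rfl fun l _ => by ring

theorem gradient_apply {n : ℕ} (f : E n → ℝ) (x : E n) (k : Fin n) :
    gradient f x k = fderiv ℝ f x (EuclideanSpace.single k 1) := by
  have h : inner ℝ (gradient f x) (EuclideanSpace.single k (1 : ℝ)) =
      fderiv ℝ f x (EuclideanSpace.single k 1) := by
    rw [gradient, InnerProductSpace.toDual_symm_apply]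
  rw [← h, EuclideanSpace.inner_single_right]
  simp

namespace MDP

variable {ns na nθ : ℕ} (M : MDP ns na)

/-- The data of the problem are smooth and dominated on the ball of radius `r` around `θs`. -/
structure LocalBounds (π : E nθ → M.S → E na) (θs : E nθ) (W : M.S → ℝ) (C lam r : ℝ) : Prop where
  reg₁ : M.FirstOrderRegular π
  reg₂ : M.SecondOrderRegular π
  W_measurable : Measurable W
  W_nonneg : ∀ s, 0 ≤ W s
  W_integrable : Integrable W M.init
  C_nonneg : 0 ≤ C
  lam_nonneg : 0 ≤ lam
  lam_lt : lam < 1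
  r_pos : 0 < r
  contract : ∀ θ ∈ Metric.ball θs r, ∀ s, ENNReal.ofReal M.γ *
    ∫⁻ s', ENNReal.ofReal (M.p s (π θ s) s') * ENNReal.ofReal (W s') ∂leb M.S ≤
      ENNReal.ofReal (lam * W s)
  cost : ∀ θ ∈ Metric.ball θs r, ∀ s, |M.ℓ s (π θ s)| ≤ C * W s ∧
    ‖fderiv ℝ (fun ϑ => M.ℓ s (π ϑ s)) θ‖ ≤ C * W s ∧
    ‖fderiv ℝ (fderiv ℝ (fun ϑ => M.ℓ s (π ϑ s))) θ‖ ≤ C * W s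
  density : ∀ s, ∃ g : M.S → ℝ, Measurable g ∧
    (∀ θ ∈ Metric.ball θs r, ∀ s', ‖fderiv ℝ (fun ϑ => M.p s (π ϑ s) s') θ‖ ≤ g s' ∧
      ‖fderiv ℝ (fderiv ℝ (fun ϑ => M.p s (π ϑ s) s')) θ‖ ≤ g s') ∧
    ∫⁻ s', ENNReal.ofReal (g s') * ENNReal.ofReal (W s') ∂leb M.S ≤ ENNReal.ofReal (C * W s)
  action : ∀ θ ∈ Metric.ball θs r, ∀ s, ∃ N ∈ 𝓝 (π θ s), ∃ g : M.S → ℝ, Measurable g ∧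
    (∀ a ∈ N, ∀ s', ‖fderiv ℝ (fun a => M.p s a s') a‖ ≤ g s' ∧
      ‖fderiv ℝ (fderiv ℝ (fun a => M.p s a s')) a‖ ≤ g s') ∧
    ∫⁻ s', ENNReal.ofReal (g s') * ENNReal.ofReal (W s') ∂leb M.S < ⊤

theorem LocallyDominated.exists_localBounds {M : MDP ns na} {π : E nθ → M.S → E na} {θs : E nθ}
    (h : M.LocallyDominated π θs) (h₁ : M.FirstOrderRegular π) (h₂ : M.SecondOrderRegular π) :
    ∃ W C lam r, M.LocalBounds π θs W C lam r := by
  obtain ⟨W, hWm, hW0, hWi, C, lam, hl0, hl1, U, hU, hdr, hc, hd, ha⟩ := h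
  obtain ⟨r, hr, hrU⟩ := Metric.mem_nhds_iff.1 hU
  have hC (s : M.S) : C * W s ≤ max C 0 * W s :=
    mul_le_mul_of_nonneg_right (le_max_left _ _) (hW0 s)
  -- The sign of `C` is not known where `W` vanishes, so it is replaced by `max C 0`.
  refine ⟨W, max C 0, lam, r, h₁, h₂, hWm, hW0, hWi, le_max_right _ _, hl0, hl1, hr,
    fun θ hθ => hdr θ (hrU hθ), fun θ hθ s => ?_, fun s => ?_, fun θ hθ => ha θ (hrU hθ)⟩
  · obtain ⟨h1, h2, h3⟩ := hc θ (hrU hθ) s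
    exact ⟨h1.trans (hC s), h2.trans (hC s), h3.trans (hC s)⟩
  · obtain ⟨g, hg, hb, hi⟩ := hd s
    exact ⟨g, hg, fun θ hθ => hb θ (hrU hθ), hi.trans (ENNReal.ofReal_le_ofReal (hC s))⟩

/-- The cost of one step under `π_ϑ` followed by the terminal cost `f`. -/
def lookahead (π : E nθ → M.S → E na) (f : M.S → ℝ) (s : M.S) (ϑ : E nθ) : ℝ :=
  M.ℓ s (π ϑ s) + M.next (π ϑ) f s

variable {M} {π : E nθ → M.S → E na} {θs : E nθ} {W : M.S → ℝ} {C lam r : ℝ}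

/-- The index is the pair (current state, next state); the policy sees only its first component. -/
theorem smoothFamily_density (h₁ : M.FirstOrderRegular π) (h₂ : M.SecondOrderRegular π) :
    SmoothFamily M.A (fun (y : M.S × M.S) a => M.p y.1 a y.2) (fun θ y => π θ y.1) := by
  have hm : Continuous fun x : (M.S × M.S) × E na => (x.1.1, x.2, x.1.2) := by fun_prop
  have hp : Continuous fun x : E nθ × (M.S × M.S) => (x.1, x.2.1) := by fun_prop
  exact
  { isOpen := M.isOpen_A
    mapsTo := fun x y => h₁.mapsTo x y.1
    f_cont := h₁.p_cont.comp hm.continuousOn fun x hx => hx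
    f_diff := fun y => h₁.p_diff y.1 y.2
    df_cont := h₁.dp_cont.comp hm.continuousOn fun x hx => hx
    f_diff₂ := fun y => h₂.p_diff y.1 y.2
    ddf_cont := h₂.ddp_cont.comp hm.continuousOn fun x hx => hx
    g_cont := h₁.π_cont.comp hp
    g_diff := fun y => h₁.π_diff y.1
    dg_cont := h₁.dπ_cont.comp hp
    g_diff₂ := fun y => h₂.π_diff y.1
    ddg_cont := h₂.ddπ_cont.comp hp }

theorem smoothFamily_cost (h₁ : M.FirstOrderRegular π) (h₂ : M.SecondOrderRegular π) :
    SmoothFamily M.A M.ℓ π :=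
  { isOpen := M.isOpen_A
    mapsTo := h₁.mapsTo
    f_cont := h₁.ℓ_cont
    f_diff := h₁.ℓ_diff
    df_cont := h₁.dℓ_cont
    f_diff₂ := h₂.ℓ_diff
    ddf_cont := h₂.ddℓ_cont
    g_cont := h₁.π_cont
    g_diff := h₁.π_diff
    dg_cont := h₁.dπ_cont
    g_diff₂ := h₂.π_diff
    ddg_cont := h₂.ddπ_cont }

namespace LocalBounds

variable (h : M.LocalBounds π θs W C lam r)
include h

theorem mem_self : θs ∈ Metric.ball θs r := Metric.mem_ball_self h.r_pos

theorem density_smooth :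
    SmoothFamily M.A (fun (y : M.S × M.S) a => M.p y.1 a y.2) (fun θ y => π θ y.1) :=
  smoothFamily_density h.reg₁ h.reg₂

theorem cost_smooth : SmoothFamily M.A M.ℓ π := smoothFamily_cost h.reg₁ h.reg₂

theorem driftOf {θ : E nθ} (hθ : θ ∈ Metric.ball θs r) : M.Drift (π θ) W lam where
  measurable := (h.density_smooth.continuous.comp (Continuous.prodMk_right θ)).measurable
  nonneg s s' := M.p_nonneg s _ (h.reg₁.mapsTo θ s) s'
  W_measurable := h.W_measurable
  W_nonneg := h.W_nonneg
  lam_nonneg := h.lam_nonneg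
  lam_lt := h.lam_lt
  drift := h.contract θ hθ

theorem weightedBdd_cost {θ : E nθ} (hθ : θ ∈ Metric.ball θs r) :
    WeightedBdd W C fun s => M.ℓ s (π θ s) :=
  ⟨h.C_nonneg, (h.cost_smooth.continuous.comp (Continuous.prodMk_right θ)).measurable,
    fun s => (h.cost θ hθ s).1⟩

theorem weightedBdd_V {θ : E nθ} (hθ : θ ∈ Metric.ball θs r) :
    WeightedBdd W (C * (1 - lam)⁻¹) (M.V (π θ)) :=
  (h.driftOf hθ).weightedBdd_total (h.weightedBdd_cost hθ)

/-- The envelope of the parameter derivatives has `W`-integral at most `C W(s)`, so against `|f| ≤ c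
W` it costs a further factor `c`. This puts every derivative of `next` back into the `W`-weighted
scale. -/
theorem exists_dominatedDensity {c : ℝ} {f : M.S → ℝ} (hf : WeightedBdd W c f) (s : M.S) :
    ∃ g, DominatedDensity (leb M.S) (fun ϑ s' => M.p s (π ϑ s) s') f g (Metric.ball θs r) ∧
      ∫ s', g s' * |f s'| ∂leb M.S ≤ C * c * W s := by
  obtain ⟨g, hg, hb, hi⟩ := h.density s
  have hS := h.density_smooth
  have hg0 : ∀ s', 0 ≤ g s' := fun s' => (norm_nonneg _).trans (hb θs h.mem_self s').1
  have hgW := integrable_mul_of_lintegral_lt_top hg h.W_measurable hg0 h.W_nonneg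
    (hi.trans_lt ENNReal.ofReal_lt_top)
  have hgf := hf.integrable_mul_abs hg hg0 hgW
  have hc (x : E nθ) : Continuous fun s' : M.S => (x, (s, s')) := by fun_prop
  refine ⟨g, ⟨Metric.isOpen_ball, convex_ball _ _, fun x _ s' => hS.diff (s, s') x,
    fun x _ s' => hS.diff₂ (s, s') x, fun x _ => ?_, fun x _ => ?_, fun x _ => ?_,
    hf.measurable.aestronglyMeasurable, fun x hx s' => (hb x hx s').1,
    fun x hx s' => (hb x hx s').2, hgf,
    ⟨θs, h.mem_self, (h.driftOf h.mem_self).integrable_density_mul hf s⟩⟩, ?_⟩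
  · exact (hS.continuous.comp (hc x)).aestronglyMeasurable
  · exact (hS.continuous_fderiv.comp (hc x)).aestronglyMeasurable
  · exact (hS.continuous_fderiv₂.comp (hc x)).aestronglyMeasurable
  · calc _ ≤ ∫ s', c * (g s' * W s') ∂leb M.S :=
          integral_mono hgf (hgW.const_mul c) fun s' => hf.mul_abs_le (hg0 s') s'
      _ = c * ∫ s', g s' * W s' ∂leb M.S := integral_const_mul _ _
      _ ≤ c * (C * W s) := mul_le_mul_of_nonneg_left
          (integral_mul_le_of_lintegral_le hg h.W_measurable hg0 h.W_nonneg
            (mul_nonneg h.C_nonneg (h.W_nonneg s)) hi) hf.nonneg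
      _ = _ := by ring

section lookahead

variable {c : ℝ} {f : M.S → ℝ} (hf : WeightedBdd W c f) (s : M.S) {θ : E nθ}
  (hθ : θ ∈ Metric.ball θs r)
include hf hθ

theorem hasFDerivAt_next : HasFDerivAt (fun ϑ => M.next (π ϑ) f s)
    (M.γ • ∫ s', f s' • fderiv ℝ (fun ϑ => M.p s (π ϑ s) s') θ ∂leb M.S) θ := by
  obtain ⟨g, hg, -⟩ := h.exists_dominatedDensity hf s
  exact (hg.hasFDerivAt hθ).const_mul M.γ

theorem hasFDerivAt_lookahead : HasFDerivAt (M.lookahead π f s)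
    (fderiv ℝ (fun ϑ => M.ℓ s (π ϑ s)) θ +
      M.γ • ∫ s', f s' • fderiv ℝ (fun ϑ => M.p s (π ϑ s) s') θ ∂leb M.S) θ :=
  (h.cost_smooth.diff s θ).hasFDerivAt.add (h.hasFDerivAt_next hf s hθ)

theorem hasFDerivAt_fderiv_lookahead : HasFDerivAt (fderiv ℝ (M.lookahead π f s))
    (fderiv ℝ (fderiv ℝ fun ϑ => M.ℓ s (π ϑ s)) θ +
      M.γ • ∫ s', f s' • fderiv ℝ (fderiv ℝ fun ϑ => M.p s (π ϑ s) s') θ ∂leb M.S) θ := by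
  obtain ⟨g, hg, -⟩ := h.exists_dominatedDensity hf s
  refine ((h.cost_smooth.diff₂ s θ).hasFDerivAt.add
    ((hg.hasFDerivAt_integral_fderiv hθ).const_smul M.γ)).congr_of_eventuallyEq ?_
  filter_upwards [Metric.isOpen_ball.mem_nhds hθ] with z hz
  exact (h.hasFDerivAt_lookahead hf s hz).fderiv

theorem norm_fderiv_next_le : ‖fderiv ℝ (fun ϑ => M.next (π ϑ) f s) θ‖ ≤ C * c * W s := by
  obtain ⟨g, hg, hb⟩ := h.exists_dominatedDensity hf s
  rw [(h.hasFDerivAt_next hf s hθ).fderiv, norm_smul, Real.norm_of_nonneg M.γ_pos.le,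
    ← (hg.hasFDerivAt hθ).fderiv]
  calc _ ≤ 1 * (C * c * W s) :=
        mul_le_mul M.γ_le_one ((hg.norm_fderiv_le hθ).trans hb) (norm_nonneg _) zero_le_one
    _ = _ := one_mul _

theorem norm_fderiv_lookahead_le :
    ‖fderiv ℝ (M.lookahead π f s) θ‖ ≤ (C + C * c) * W s := by
  rw [(h.hasFDerivAt_lookahead hf s hθ).fderiv, ← (h.hasFDerivAt_next hf s hθ).fderiv, add_mul]
  exact (norm_add_le _ _).trans
    (add_le_add (h.cost θ hθ s).2.1 (h.norm_fderiv_next_le hf s hθ))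

theorem norm_fderiv₂_lookahead_le :
    ‖fderiv ℝ (fderiv ℝ (M.lookahead π f s)) θ‖ ≤ (C + C * c) * W s := by
  obtain ⟨g, hg, hb⟩ := h.exists_dominatedDensity hf s
  have h2 := (hg.norm_fderiv₂_le hθ).trans hb
  rw [(hg.hasFDerivAt_fderiv hθ).fderiv] at h2
  rw [(h.hasFDerivAt_fderiv_lookahead hf s hθ).fderiv, add_mul]
  exact norm_add_smul_le (V := E nθ →L[ℝ] E nθ →L[ℝ] ℝ) (h.cost θ hθ s).2.2 h2
    M.γ_pos.le M.γ_le_one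

/-- Lipschitz dependence of the discounted transition on `θ` in the weighted norm; it feeds the
resolvent estimate `abs_total_sub_total_le`. -/
theorem abs_next_sub_next_le :
    |M.next (π θ) f s - M.next (π θs) f s| ≤ C * ‖θ - θs‖ * c * W s := by
  have := (convex_ball θs r).norm_image_sub_le_of_norm_fderiv_le
    (fun z hz => (h.hasFDerivAt_next hf s hz).differentiableAt)
    (fun z hz => h.norm_fderiv_next_le hf s hz) h.mem_self hθ
  rw [Real.norm_eq_abs] at this
  exact this.trans_eq (by ring)

theorem abs_lookahead_sub_le :
    |M.lookahead π f s θ - M.lookahead π f s θs| ≤ (C + C * c) * ‖θ - θs‖ * W s := by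
  have := (convex_ball θs r).norm_image_sub_le_of_norm_fderiv_le
    (fun z hz => (h.hasFDerivAt_lookahead hf s hz).differentiableAt)
    (fun z hz => h.norm_fderiv_lookahead_le hf s hz) h.mem_self hθ
  rw [Real.norm_eq_abs] at this
  exact this.trans_eq (by ring)

omit s in
theorem measurable_fderiv_lookahead (u : E nθ) :
    Measurable fun s => fderiv ℝ (M.lookahead π f s) θ u := by
  simp_rw [(h.hasFDerivAt_lookahead hf _ hθ).fderiv]
  have hS := h.density_smooth
  have hc : Continuous fun y : M.S × M.S => (θ, y) := by fun_prop
  have hj : StronglyMeasurable (Function.uncurry fun s s' : M.S =>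
      f s' • fderiv ℝ (fun ϑ => M.p s (π ϑ s) s') θ) :=
    (hf.measurable.comp measurable_snd).stronglyMeasurable.smul
      (hS.continuous_fderiv.comp hc).stronglyMeasurable
  have hi := hj.integral_prod_right (ν := leb M.S)
  have hℓ : StronglyMeasurable fun s => fderiv ℝ (fun ϑ => M.ℓ s (π ϑ s)) θ :=
    (h.cost_smooth.continuous_fderiv.comp (Continuous.prodMk_right θ)).stronglyMeasurable
  exact ((ContinuousLinearMap.apply ℝ ℝ u).continuous.comp_stronglyMeasurable
    (hℓ.add (hi.const_smul M.γ))).measurable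

omit s in
theorem measurable_fderiv₂_lookahead (u v : E nθ) :
    Measurable fun s => fderiv ℝ (fderiv ℝ (M.lookahead π f s)) θ u v := by
  simp_rw [(h.hasFDerivAt_fderiv_lookahead hf _ hθ).fderiv]
  have hS := h.density_smooth
  have hc : Continuous fun y : M.S × M.S => (θ, y) := by fun_prop
  have hj : StronglyMeasurable (Function.uncurry fun s s' : M.S =>
      f s' • fderiv ℝ (fderiv ℝ fun ϑ => M.p s (π ϑ s) s') θ) :=
    (hf.measurable.comp measurable_snd).stronglyMeasurable.smul
      (hS.continuous_fderiv₂.comp hc).stronglyMeasurable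
  have hi := StronglyMeasurable.integral_prod_right (E := E nθ →L[ℝ] E nθ →L[ℝ] ℝ)
    (ν := leb M.S) hj
  have hℓ : StronglyMeasurable fun s => fderiv ℝ (fderiv ℝ fun ϑ => M.ℓ s (π ϑ s)) θ :=
    (h.cost_smooth.continuous_fderiv₂.comp (Continuous.prodMk_right θ)).stronglyMeasurable
  have hev : Continuous fun T : E nθ →L[ℝ] E nθ →L[ℝ] ℝ => T u v := by fun_prop
  exact (hev.comp_stronglyMeasurable (hℓ.add (hi.const_smul M.γ))).measurable

omit s in
theorem weightedBdd_fderiv_lookahead (u : E nθ) :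
    WeightedBdd W ((C + C * c) * ‖u‖) fun s => fderiv ℝ (M.lookahead π f s) θ u := by
  have hC := h.C_nonneg
  have hc := hf.nonneg
  refine ⟨by positivity, h.measurable_fderiv_lookahead hf hθ u, fun s => ?_⟩
  rw [← Real.norm_eq_abs]
  refine (ContinuousLinearMap.le_of_opNorm_le _ (h.norm_fderiv_lookahead_le hf s hθ) u).trans_eq ?_
  ring

omit s in
theorem weightedBdd_fderiv₂_lookahead (u v : E nθ) :
    WeightedBdd W ((C + C * c) * ‖u‖ * ‖v‖)
      fun s => fderiv ℝ (fderiv ℝ (M.lookahead π f s)) θ u v := by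
  have hC := h.C_nonneg
  have hc := hf.nonneg
  refine ⟨by positivity, h.measurable_fderiv₂_lookahead hf hθ u v, fun s => ?_⟩
  rw [← Real.norm_eq_abs]
  refine (ContinuousLinearMap.le_of_opNorm_le _ (ContinuousLinearMap.le_of_opNorm_le _
    (h.norm_fderiv₂_lookahead_le hf s hθ) u) v).trans_eq ?_
  ring

end lookahead

/-! ### The integrand of `H` as a second derivative of the lookahead. -/

omit h in
theorem lookahead_eq_Q (θ : E nθ) (s : M.S) :
    M.lookahead π (M.V (π θ)) s = fun ϑ => M.Q (π θ) s (π ϑ s) := rfl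

/-- Here the density is differentiated in the action, not in the policy parameter: `H` involves
action derivatives of `Q`, whose existence rests on the separate local envelope. -/
theorem exists_dominatedDensity_action {θ : E nθ} (hθ : θ ∈ Metric.ball θs r) (s : M.S) :
    ∃ g, ∃ ρ > 0, Metric.ball (π θ s) ρ ⊆ M.A ∧
      DominatedDensity (leb M.S) (fun a s' => M.p s a s') (M.V (π θ)) g
        (Metric.ball (π θ s) ρ) := by
  obtain ⟨N, hN, g, hg, hb, hi⟩ := h.action θ hθ s
  have hf := h.weightedBdd_V hθ
  have hA := M.isOpen_A
  obtain ⟨ρ, hρ, hsub⟩ := Metric.mem_nhds_iff.1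
    (inter_mem hN (hA.mem_nhds (h.reg₁.mapsTo θ s)))
  have hg0 : ∀ s', 0 ≤ g s' := fun s' => (norm_nonneg _).trans (hb _ (mem_of_mem_nhds hN) s').1
  have hgW := integrable_mul_of_lintegral_lt_top hg h.W_measurable hg0 h.W_nonneg hi
  have hc (a : E na) : Continuous fun s' : M.S => (s, a, s') := by fun_prop
  refine ⟨g, ρ, hρ, fun a ha => (hsub ha).2, Metric.isOpen_ball, convex_ball _ _,
    fun a ha s' => (h.reg₁.p_diff s s').differentiableAt (hA.mem_nhds (hsub ha).2),
    fun a ha s' => (h.reg₂.p_diff s s').differentiableAt (hA.mem_nhds (hsub ha).2),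
    fun a ha => ?_, fun a ha => ?_, fun a ha => ?_,
    hf.measurable.aestronglyMeasurable, fun a ha s' => (hb a (hsub ha).1 s').1,
    fun a ha s' => (hb a (hsub ha).1 s').2, hf.integrable_mul_abs hg hg0 hgW,
    ⟨π θ s, Metric.mem_ball_self hρ, (h.driftOf hθ).integrable_density_mul hf s⟩⟩
  · exact (h.reg₁.p_cont.comp_continuous (hc a) fun _ => (hsub ha).2).aestronglyMeasurable
  · exact (h.reg₁.dp_cont.comp_continuous (hc a) fun _ => (hsub ha).2).aestronglyMeasurable
  · exact (h.reg₂.ddp_cont.comp_continuous (hc a) fun _ => (hsub ha).2).aestronglyMeasurable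

/-- With the terminal cost `V^{π_θ}` frozen, the lookahead is `ϑ ↦ Q(s, π_ϑ(s))`; the two summands
of the integrand are the two terms of the second-order chain rule. -/
theorem hessIntegrand_eq {θ : E nθ} (hθ : θ ∈ Metric.ball θs r) (s : M.S) (i j : Fin nθ) :
    M.hessIntegrand π θ s i j = fderiv ℝ (fderiv ℝ (M.lookahead π (M.V (π θ)) s)) θ
      (EuclideanSpace.single i 1) (EuclideanSpace.single j 1) := by
  obtain ⟨g, ρ, hρ, hsub, hd⟩ := h.exists_dominatedDensity_action hθ s
  have hA := M.isOpen_A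
  have hQ (a : E na) (ha : a ∈ Metric.ball (π θ s) ρ) : HasFDerivAt (M.Q (π θ) s)
      (fderiv ℝ (M.ℓ s) a +
        M.γ • ∫ s', M.V (π θ) s' • fderiv ℝ (fun z => M.p s z s') a ∂leb M.S) a :=
    ((h.reg₁.ℓ_diff s).differentiableAt (hA.mem_nhds (hsub ha))).hasFDerivAt.add
      ((hd.hasFDerivAt ha).const_mul M.γ)
  have hmem := Metric.mem_ball_self (x := π θ s) hρ
  have hQ₂ : DifferentiableAt ℝ (fderiv ℝ (M.Q (π θ) s)) (π θ s) := by
    refine DifferentiableAt.congr_of_eventuallyEq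
      (((h.reg₂.ℓ_diff s).differentiableAt (hA.mem_nhds (hsub hmem))).add
        ((hd.hasFDerivAt_integral_fderiv hmem).differentiableAt.const_smul M.γ)) ?_
    filter_upwards [Metric.ball_mem_nhds _ hρ] with a ha
    exact (hQ a ha).fderiv
  have hev : ∀ᶠ a in 𝓝 (π θ s), DifferentiableAt ℝ (M.Q (π θ) s) a := by
    filter_upwards [Metric.ball_mem_nhds _ hρ] with a ha
    exact (hQ a ha).differentiableAt
  have hcomp := (hasFDerivAt_fderiv_comp (g := fun ϑ => π ϑ s) hev hQ₂ (h.reg₁.π_diff s)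
    (h.reg₂.π_diff s θ)).fderiv
  -- What remains is to match the invariant chain rule with its matrix form in coordinates.
  rw [lookahead_eq_Q, hcomp, secondComp_apply, clm_apply_eq_sum, clm_apply₂_eq_sum]
  simp only [hessIntegrand, Matrix.add_apply, tensorVec, Matrix.of_apply, gradient_apply]
  congr 1
  · exact Finset.sum_congr rfl fun k _ => mul_comm _ _
  · simp only [Matrix.mul_apply, Matrix.transpose_apply, policyJac, hessian, Matrix.of_apply,
      Finset.sum_mul]
    rw [Finset.sum_comm]
    exact Finset.sum_congr rfl fun k _ => Finset.sum_congr rfl fun l _ => by ring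

end LocalBounds

end MDP

/-! ### Expansion of the performance at an optimal policy -/

namespace MDP

variable {ns na nθ : ℕ} (M : MDP ns na)

/-- The advantage of one step of `π_θ` over `π_θs`, followed by `π_θs`. -/
def gap (π : E nθ → M.S → E na) (θs θ : E nθ) (s : M.S) : ℝ :=
  M.lookahead π (M.V (π θs)) s θ - M.V (π θs) s

variable {M} {π : E nθ → M.S → E na} {θs : E nθ} {W : M.S → ℝ} {C lam r : ℝ}

instance sFinite_init : SFinite M.init := by
  unfold MDP.init
  infer_instance

namespace LocalBounds

variable (h : M.LocalBounds π θs W C lam r)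
include h

theorem lookahead_self (s : M.S) : M.lookahead π (M.V (π θs)) s θs = M.V (π θs) s :=
  ((h.driftOf h.mem_self).total_eq_add_next_total (h.weightedBdd_cost h.mem_self) s).symm

theorem gap_eq (θ : E nθ) (s : M.S) : M.gap π θs θ s =
    M.lookahead π (M.V (π θs)) s θ - M.lookahead π (M.V (π θs)) s θs := by
  rw [gap, h.lookahead_self]

/-- The performance difference identity: the comparison lemma for the chain of `π_θ`, with `f` its
stage cost and `g = V^{π_θs}`. -/
theorem V_sub_eq {θ : E nθ} (hθ : θ ∈ Metric.ball θs r) (s : M.S) :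
    M.V (π θ) s - M.V (π θs) s = M.total (π θ) (M.gap π θs θ) s :=
  (h.driftOf hθ).total_sub_eq_total (h.weightedBdd_cost hθ) (h.weightedBdd_V h.mem_self) s

theorem measurable_gap {θ : E nθ} (hθ : θ ∈ Metric.ball θs r) : Measurable (M.gap π θs θ) :=
  ((h.weightedBdd_cost hθ).measurable.add ((h.driftOf hθ).weightedBdd_next
    (h.weightedBdd_V h.mem_self)).measurable).sub (h.weightedBdd_V h.mem_self).measurable

theorem weightedBdd_gap {θ : E nθ} (hθ : θ ∈ Metric.ball θs r) :
    WeightedBdd W ((C + C * (C * (1 - lam)⁻¹)) * ‖θ - θs‖) (M.gap π θs θ) := by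
  have hV := h.weightedBdd_V h.mem_self
  refine ⟨mul_nonneg (add_nonneg h.C_nonneg (mul_nonneg h.C_nonneg hV.nonneg)) (norm_nonneg _),
    h.measurable_gap hθ, fun s => ?_⟩
  rw [h.gap_eq]
  exact h.abs_lookahead_sub_le hV s hθ

theorem weightedBdd_gap_of_fderiv_eq_zero
    (h0 : ∀ s, fderiv ℝ (M.lookahead π (M.V (π θs)) s) θs = 0) {θ : E nθ}
    (hθ : θ ∈ Metric.ball θs r) :
    WeightedBdd W ((C + C * (C * (1 - lam)⁻¹)) * ‖θ - θs‖ ^ 2) (M.gap π θs θ) := by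
  have hV := h.weightedBdd_V h.mem_self
  refine ⟨mul_nonneg (add_nonneg h.C_nonneg (mul_nonneg h.C_nonneg hV.nonneg)) (by positivity),
    h.measurable_gap hθ, fun s => ?_⟩
  rw [h.gap_eq]
  refine (abs_sub_le_of_fderiv_eq_zero
    (fun z hz => (h.hasFDerivAt_lookahead hV s hz).differentiableAt)
    (fun z hz => (h.hasFDerivAt_fderiv_lookahead hV s hz).differentiableAt)
    (fun z hz => h.norm_fderiv₂_lookahead_le hV s hz) (h0 s) hθ).trans_eq ?_
  ring

/-- Replacing the closed loop of `π_θ` by that of `π_θs` costs a factor `‖θ - θs‖`. -/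
theorem abs_integral_occ_sub_le {μ : Measure M.S} [SFinite μ] (hμ : Integrable W μ) {θ : E nθ}
    (hθ : θ ∈ Metric.ball θs r) {d : ℝ} {φ : M.S → ℝ} (hφ : WeightedBdd W d φ) :
    |∫ s, φ s ∂M.occ μ (π θ) - ∫ s, φ s ∂M.occ μ (π θs)| ≤
      C * ‖θ - θs‖ * (d * (1 - lam)⁻¹) * (1 - lam)⁻¹ * ∫ s, W s ∂μ := by
  have hd := h.driftOf hθ
  have hd' := h.driftOf h.mem_self
  rw [hd.integral_occ_eq hμ hφ, hd'.integral_occ_eq hμ hφ,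
    ← integral_sub ((hd.weightedBdd_total hφ).integrable hμ)
      ((hd'.weightedBdd_total hφ).integrable hμ)]
  exact (hd.abs_total_sub_total_le hd' (mul_nonneg h.C_nonneg (norm_nonneg _))
    (fun c f hf s => h.abs_next_sub_next_le hf s hθ) hφ).abs_integral_le hμ

theorem integral_V_sub_eq {μ : Measure M.S} [SFinite μ] (hμ : Integrable W μ) {θ : E nθ}
    (hθ : θ ∈ Metric.ball θs r) :
    ∫ s, M.V (π θ) s ∂μ - ∫ s, M.V (π θs) s ∂μ = ∫ s, M.gap π θs θ s ∂M.occ μ (π θ) := by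
  rw [(h.driftOf hθ).integral_occ_eq hμ (h.weightedBdd_gap hθ),
    ← integral_sub ((h.weightedBdd_V hθ).integrable hμ)
      ((h.weightedBdd_V h.mem_self).integrable hμ)]
  simp_rw [h.V_sub_eq hθ]

omit h in
theorem tendsto_line (θs v : E nθ) : Tendsto (fun t : ℝ => θs + t • v) (𝓝[≠] 0) (𝓝 θs) := by
  have : Continuous fun t : ℝ => θs + t • v := by fun_prop
  simpa using (this.tendsto 0).mono_left nhdsWithin_le_nhds

theorem eventually_line_mem (v : E nθ) :
    ∀ᶠ t : ℝ in 𝓝[≠] 0, θs + t • v ∈ Metric.ball θs r :=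
  (tendsto_line θs v).eventually (Metric.ball_mem_nhds _ h.r_pos)

/-- If the gap is `O(|t| ^ m)` along a line, its limit at scale `t ^ m` determines the expansion of
the expected value at that scale. -/
theorem tendsto_integral_V_sub {μ : Measure M.S} [SFinite μ] (hμ : Integrable W μ) (v : E nθ)
    (m : ℕ) {d : ℝ} {φ : M.S → ℝ}
    (hgap : ∀ᶠ t : ℝ in 𝓝[≠] 0, WeightedBdd W (d * |t| ^ m) (M.gap π θs (θs + t • v)))
    (hlim : ∀ s, Tendsto (fun t : ℝ => (t ^ m)⁻¹ * M.gap π θs (θs + t • v) s) (𝓝[≠] 0)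
      (𝓝 (φ s))) :
    Tendsto (fun t : ℝ => (t ^ m)⁻¹ *
      (∫ s, M.V (π (θs + t • v)) s ∂μ - ∫ s, M.V (π θs) s ∂μ)) (𝓝[≠] 0)
      (𝓝 (∫ s, φ s ∂M.occ μ (π θs))) := by
  have hWi := (h.driftOf h.mem_self).integrable_occ hμ
  have hne : ∀ᶠ t : ℝ in 𝓝[≠] 0, t ≠ 0 := self_mem_nhdsWithin
  have hmain : Tendsto (fun t : ℝ => ∫ s, (t ^ m)⁻¹ * M.gap π θs (θs + t • v) s
      ∂M.occ μ (π θs)) (𝓝[≠] 0) (𝓝 (∫ s, φ s ∂M.occ μ (π θs))) := by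
    refine tendsto_integral_filter_of_dominated_convergence (fun s => d * W s) ?_ ?_
      (hWi.const_mul d) (ae_of_all _ hlim)
    · filter_upwards [hgap] with t ht
      exact (ht.measurable.const_mul _).aestronglyMeasurable
    · filter_upwards [hgap, hne] with t ht ht0
      refine ae_of_all _ fun s => ?_
      have hp : 0 < |t| ^ m := pow_pos (abs_pos.2 ht0) m
      rw [Real.norm_eq_abs, abs_mul, abs_inv, abs_pow, inv_mul_le_iff₀ hp]
      exact (ht.bound s).trans_eq (by ring)
  -- The gap is already of order `|t| ^ m`, and exchanging the chains contributes one more factor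
  -- `|t|`.
  have herr : Tendsto (fun t : ℝ => (t ^ m)⁻¹ *
      (∫ s, M.gap π θs (θs + t • v) s ∂M.occ μ (π (θs + t • v)) -
        ∫ s, M.gap π θs (θs + t • v) s ∂M.occ μ (π θs))) (𝓝[≠] 0) (𝓝 0) := by
    have hz : Tendsto (fun t : ℝ => C * ‖v‖ * d * (1 - lam)⁻¹ * (1 - lam)⁻¹ *
        (∫ s, W s ∂μ) * |t|) (𝓝[≠] 0) (𝓝 0) := by
      have : Continuous fun t : ℝ => C * ‖v‖ * d * (1 - lam)⁻¹ * (1 - lam)⁻¹ *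
        (∫ s, W s ∂μ) * |t| := by fun_prop
      simpa using (this.tendsto 0).mono_left nhdsWithin_le_nhds
    refine squeeze_zero_norm' ?_ hz
    filter_upwards [hgap, hne, h.eventually_line_mem v] with t ht ht0 hb
    have hp : 0 < |t| ^ m := pow_pos (abs_pos.2 ht0) m
    rw [Real.norm_eq_abs, abs_mul, abs_inv, abs_pow, inv_mul_le_iff₀ hp]
    refine (h.abs_integral_occ_sub_le hμ hb ht).trans_eq ?_
    rw [add_sub_cancel_left, norm_smul, Real.norm_eq_abs]
    ring
  have hsum := hmain.add herr
  rw [add_zero] at hsum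
  refine hsum.congr' ?_
  filter_upwards [h.eventually_line_mem v] with t hb
  rw [h.integral_V_sub_eq hμ hb, integral_const_mul]
  ring

/-- At an optimal policy, the one-step lookahead is stationary. -/
theorem fderiv_lookahead_eq_zero (hopt : M.IsOptimal (π θs)) (s : M.S) :
    fderiv ℝ (M.lookahead π (M.V (π θs)) s) θs = 0 := by
  have hV := h.weightedBdd_V h.mem_self
  have hd := h.driftOf h.mem_self
  have hnonneg (v : E nθ) (s₀ : M.S) :
      0 ≤ M.total (π θs) (fun s => fderiv ℝ (M.lookahead π (M.V (π θs)) s) θs v) s₀ := by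
    have hlim := h.tendsto_integral_V_sub (hd.integrable_dirac s₀) v 1
      (d := (C + C * (C * (1 - lam)⁻¹)) * ‖v‖)
      (φ := fun s => fderiv ℝ (M.lookahead π (M.V (π θs)) s) θs v) ?_ ?_
    -- Only `t > 0` is used, where the quotient is nonnegative by optimality of `π θs`.
    · refine ge_of_tendsto (hlim.mono_left (nhdsGT_le_nhdsNE 0)) ?_
      filter_upwards [nhdsGT_le_nhdsNE 0 (h.eventually_line_mem v), self_mem_nhdsWithin]
        with t hb ht
      have hVt := h.weightedBdd_V hb
      rw [integral_dirac' _ _ hVt.measurable.stronglyMeasurable,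
        integral_dirac' _ _ hV.measurable.stronglyMeasurable, pow_one]
      have hπ : Continuous (π (θs + t • v)) :=
        h.reg₁.π_cont.comp (Continuous.prodMk_right (θs + t • v))
      exact mul_nonneg (inv_nonneg.2 (le_of_lt ht)) (sub_nonneg.2 (hopt.2 _ hπ.measurable
        (h.reg₁.mapsTo _) s₀ ((h.driftOf hb).finiteCost (h.weightedBdd_cost hb) s₀)))
    · filter_upwards [h.eventually_line_mem v] with t hb
      have := h.weightedBdd_gap hb
      rw [add_sub_cancel_left, norm_smul, Real.norm_eq_abs] at this
      convert this using 1
      ring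
    · intro s
      simp_rw [h.gap_eq, pow_one]
      exact tendsto_slope_line (h.hasFDerivAt_lookahead hV s h.mem_self).differentiableAt v
  have hzero (v : E nθ) :
      M.total (π θs) (fun s => fderiv ℝ (M.lookahead π (M.V (π θs)) s) θs v) = fun _ => 0 := by
    funext s₀
    refine le_antisymm ?_ (hnonneg v s₀)
    -- The limit is linear in `v`, so nonnegativity in both directions forces it to vanish.
    have := hnonneg (-v) s₀
    simp only [map_neg, total] at this
    rw [integral_neg] at this
    exact neg_nonneg.1 this
  ext v
  -- The total vanishes from every state, not merely on average, so the Bellman equation leaves only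
  -- the value of the derivative at `s`.
  have := hd.total_eq_add_next_total (h.weightedBdd_fderiv_lookahead hV h.mem_self v) s
  rw [hzero] at this
  simpa [next] using this.symm

theorem fderiv₂_J_self (hopt : M.IsOptimal (π θs))
    (hJ : ∀ᶠ θ in 𝓝 θs, DifferentiableAt ℝ (M.J π) θ)
    (hJ₂ : DifferentiableAt ℝ (fderiv ℝ (M.J π)) θs) (hJ0 : fderiv ℝ (M.J π) θs = 0) (v : E nθ) :
    fderiv ℝ (fderiv ℝ (M.J π)) θs v v =
      ∫ s, fderiv ℝ (fderiv ℝ (M.lookahead π (M.V (π θs)) s)) θs v v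
        ∂M.occ M.init (π θs) := by
  have hV := h.weightedBdd_V h.mem_self
  have h0 := h.fderiv_lookahead_eq_zero hopt
  have h1 := tendsto_second_slope_line hJ hJ₂ hJ0 v
  have h2 := h.tendsto_integral_V_sub h.W_integrable v 2
    (d := (C + C * (C * (1 - lam)⁻¹)) * ‖v‖ ^ 2)
    (φ := fun s => fderiv ℝ (fderiv ℝ (M.lookahead π (M.V (π θs)) s)) θs v v / 2) ?_ ?_
  · rw [integral_div] at h2
    have := tendsto_nhds_unique h1 (h2.congr fun t => by rw [div_eq_inv_mul]; rfl)
    linarith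
  · filter_upwards [h.eventually_line_mem v] with t hb
    have := h.weightedBdd_gap_of_fderiv_eq_zero h0 hb
    rw [add_sub_cancel_left, norm_smul, Real.norm_eq_abs] at this
    convert this using 1
    ring
  · intro s
    simp_rw [h.gap_eq, ← div_eq_inv_mul]
    refine tendsto_second_slope_line ?_
      (h.hasFDerivAt_fderiv_lookahead hV s h.mem_self).differentiableAt (h0 s) v
    filter_upwards [Metric.ball_mem_nhds _ h.r_pos] with z hz
    exact (h.hasFDerivAt_lookahead hV s hz).differentiableAt

/-- At an optimal policy the approximate Hessian is the Hessian of the performance. -/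
theorem H_self (hopt : M.IsOptimal (π θs))
    (hJ : ∀ᶠ θ in 𝓝 θs, DifferentiableAt ℝ (M.J π) θ)
    (hJ₂ : DifferentiableAt ℝ (fderiv ℝ (M.J π)) θs) (hJ0 : fderiv ℝ (M.J π) θs = 0) :
    M.H π θs = hessian (M.J π) θs := by
  have hV := h.weightedBdd_V h.mem_self
  have hWi := (h.driftOf h.mem_self).integrable_occ h.W_integrable
  set T : M.S → E nθ →L[ℝ] E nθ →L[ℝ] ℝ :=
    fun s => fderiv ℝ (fderiv ℝ (M.lookahead π (M.V (π θs)) s)) θs with hT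
  have hTi (u v : E nθ) : Integrable (fun s => T s u v) (M.occ M.init (π θs)) :=
    (h.weightedBdd_fderiv₂_lookahead hV h.mem_self u v).integrable hWi
  have hTs (s : M.S) (u v : E nθ) : T s u v = T s v u := by
    refine second_derivative_symmetric_of_eventually (f := M.lookahead π (M.V (π θs)) s)
      (f' := fderiv ℝ (M.lookahead π (M.V (π θs)) s)) (x := θs) ?_
      (h.hasFDerivAt_fderiv_lookahead hV s h.mem_self).differentiableAt.hasFDerivAt u v
    filter_upwards [Metric.ball_mem_nhds _ h.r_pos] with z hz
    exact (h.hasFDerivAt_lookahead hV s hz).differentiableAt.hasFDerivAt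
  have hJs (u v : E nθ) : fderiv ℝ (fderiv ℝ (M.J π)) θs u v =
      fderiv ℝ (fderiv ℝ (M.J π)) θs v u :=
    second_derivative_symmetric_of_eventually (hJ.mono fun z hz => hz.hasFDerivAt)
      hJ₂.hasFDerivAt u v
  have hq (v : E nθ) := h.fderiv₂_J_self hopt hJ hJ₂ hJ0 v
  -- The line expansion only yields the quadratic form; both bilinear forms are symmetric, so
  -- polarization recovers the full matrix.
  have hpolar (u v : E nθ) :
      fderiv ℝ (fderiv ℝ (M.J π)) θs u v = ∫ s, T s u v ∂M.occ M.init (π θs) := by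
    have h1 := hq (u + v)
    have h2 : ∫ s, T s (u + v) (u + v) ∂M.occ M.init (π θs) =
        ∫ s, T s u u ∂M.occ M.init (π θs) + 2 * ∫ s, T s u v ∂M.occ M.init (π θs) +
          ∫ s, T s v v ∂M.occ M.init (π θs) := by
      rw [← integral_const_mul, ← integral_add (hTi u u) ((hTi u v).const_mul 2),
        ← integral_add (f := fun s => T s u u + 2 * T s u v)
          ((hTi u u).add ((hTi u v).const_mul 2)) (hTi v v)]
      refine integral_congr_ae (ae_of_all _ fun s => ?_)
      simp only [map_add, add_apply]
      rw [hTs s v u]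
      ring
    have h3 : fderiv ℝ (fderiv ℝ (M.J π)) θs (u + v) (u + v) =
        fderiv ℝ (fderiv ℝ (M.J π)) θs u u + 2 * fderiv ℝ (fderiv ℝ (M.J π)) θs u v +
          fderiv ℝ (fderiv ℝ (M.J π)) θs v v := by
      simp only [map_add, add_apply]
      rw [hJs v u]
      ring
    have h4 := hq u
    have h5 := hq v
    linarith
  ext i j
  simp only [H, hessian, Matrix.of_apply, h.hessIntegrand_eq h.mem_self]
  exact (hpolar _ _).symm

/-! ### Continuity of the approximate Hessian. -/

theorem tendsto_V (s : M.S) : Tendsto (fun θ => M.V (π θ) s) (𝓝 θs) (𝓝 (M.V (π θs) s)) := by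
  rw [tendsto_iff_norm_sub_tendsto_zero]
  have hz : Tendsto (fun θ => (C + C * (C * (1 - lam)⁻¹)) * ‖θ - θs‖ * (1 - lam)⁻¹ * W s)
      (𝓝 θs) (𝓝 0) := by
    have : Continuous fun θ : E nθ =>
        (C + C * (C * (1 - lam)⁻¹)) * ‖θ - θs‖ * (1 - lam)⁻¹ * W s := by fun_prop
    simpa using this.tendsto θs
  refine squeeze_zero' (Eventually.of_forall fun _ => norm_nonneg _) ?_ hz
  filter_upwards [Metric.ball_mem_nhds _ h.r_pos] with θ hθ
  rw [h.V_sub_eq hθ, Real.norm_eq_abs]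
  exact ((h.driftOf hθ).weightedBdd_total (h.weightedBdd_gap hθ)).bound s

/-- The terminal value and the point of differentiation move together; the bound on `V` is uniform
near `θs`, so one envelope dominates the integrals. -/
theorem tendsto_fderiv₂_lookahead (s : M.S) :
    Tendsto (fun θ => fderiv ℝ (fderiv ℝ (M.lookahead π (M.V (π θ)) s)) θ) (𝓝 θs)
      (𝓝 (fderiv ℝ (fderiv ℝ (M.lookahead π (M.V (π θs)) s)) θs)) := by
  obtain ⟨g, hg, hb, hi⟩ := h.density s
  have hg0 : ∀ s', 0 ≤ g s' := fun s' => (norm_nonneg _).trans (hb θs h.mem_self s').1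
  have hgW := integrable_mul_of_lintegral_lt_top hg h.W_measurable hg0 h.W_nonneg
    (hi.trans_lt ENNReal.ofReal_lt_top)
  have hS := h.density_smooth.continuous_fderiv₂
  have hball := Metric.ball_mem_nhds θs h.r_pos
  have hint : Tendsto (fun θ => ∫ s', M.V (π θ) s' •
        fderiv ℝ (fderiv ℝ fun ϑ => M.p s (π ϑ s) s') θ ∂leb M.S) (𝓝 θs)
      (𝓝 (∫ s', M.V (π θs) s' •
        fderiv ℝ (fderiv ℝ fun ϑ => M.p s (π ϑ s) s') θs ∂leb M.S)) := by
    refine tendsto_integral_filter_of_dominated_convergence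
      (G := E nθ →L[ℝ] E nθ →L[ℝ] ℝ)
      (fun s' => (C * (1 - lam)⁻¹) * (g s' * W s')) ?_ ?_ (hgW.const_mul _) ?_
    · filter_upwards [hball] with θ hθ
      have hc : Continuous fun s' : M.S => (θ, (s, s')) := by fun_prop
      exact (h.weightedBdd_V hθ).measurable.aestronglyMeasurable.smul
        (hS.comp hc).aestronglyMeasurable
    · filter_upwards [hball] with θ hθ
      refine ae_of_all _ fun s' => ?_
      exact (norm_smul_le_mul_abs (V := E nθ →L[ℝ] E nθ →L[ℝ] ℝ) (hb θ hθ s').2).trans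
        ((h.weightedBdd_V hθ).mul_abs_le (hg0 s') s')
    · refine ae_of_all _ fun s' => (h.tendsto_V s').smul ?_
      exact (hS.comp (Continuous.prodMk_left (s, s'))).tendsto θs
  have hℓ : Tendsto (fun θ => fderiv ℝ (fderiv ℝ fun ϑ => M.ℓ s (π ϑ s)) θ) (𝓝 θs)
      (𝓝 (fderiv ℝ (fderiv ℝ fun ϑ => M.ℓ s (π ϑ s)) θs)) :=
    (h.cost_smooth.continuous_fderiv₂.comp (Continuous.prodMk_left s)).tendsto θs
  rw [(h.hasFDerivAt_fderiv_lookahead (h.weightedBdd_V h.mem_self) s h.mem_self).fderiv]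
  refine (hℓ.add (hint.const_smul M.γ)).congr' ?_
  filter_upwards [hball] with θ hθ
  exact (h.hasFDerivAt_fderiv_lookahead (h.weightedBdd_V hθ) s hθ).fderiv.symm

/-- The approximate Hessian is continuous at the reference parameter. -/
theorem tendsto_H : Tendsto (M.H π) (𝓝 θs) (𝓝 (M.H π θs)) := by
  refine tendsto_pi_nhds.2 fun i => tendsto_pi_nhds.2 fun j => ?_
  set u : E nθ := EuclideanSpace.single i 1
  set v : E nθ := EuclideanSpace.single j 1
  have hball := Metric.ball_mem_nhds θs h.r_pos
  have hWi := (h.driftOf h.mem_self).integrable_occ h.W_integrable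
  have hbd (θ : E nθ) (hθ : θ ∈ Metric.ball θs r) :=
    h.weightedBdd_fderiv₂_lookahead (h.weightedBdd_V hθ) hθ u v
  -- Both integrand and state distribution depend on `θ`: the integrand is treated first under the
  -- fixed distribution of `π θs`, and `herr` absorbs the change of distribution.
  have hmain : Tendsto (fun θ => ∫ s, fderiv ℝ (fderiv ℝ (M.lookahead π (M.V (π θ)) s)) θ u v
      ∂M.occ M.init (π θs)) (𝓝 θs) (𝓝 (∫ s,
        fderiv ℝ (fderiv ℝ (M.lookahead π (M.V (π θs)) s)) θs u v ∂M.occ M.init (π θs))) := by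
    refine tendsto_integral_filter_of_dominated_convergence _ ?_ ?_
      (hWi.const_mul ((C + C * (C * (1 - lam)⁻¹)) * ‖u‖ * ‖v‖)) ?_
    · filter_upwards [hball] with θ hθ
      exact (hbd θ hθ).measurable.aestronglyMeasurable
    · filter_upwards [hball] with θ hθ
      exact ae_of_all _ (hbd θ hθ).bound
    · refine ae_of_all _ fun s => ?_
      have hev : Continuous fun T : E nθ →L[ℝ] E nθ →L[ℝ] ℝ => T u v := by fun_prop
      exact (hev.tendsto _).comp (h.tendsto_fderiv₂_lookahead s)
  have herr : Tendsto (fun θ =>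
      ∫ s, fderiv ℝ (fderiv ℝ (M.lookahead π (M.V (π θ)) s)) θ u v ∂M.occ M.init (π θ) -
      ∫ s, fderiv ℝ (fderiv ℝ (M.lookahead π (M.V (π θ)) s)) θ u v ∂M.occ M.init (π θs))
      (𝓝 θs) (𝓝 0) := by
    have hz : Tendsto (fun θ => C * ‖θ - θs‖ * ((C + C * (C * (1 - lam)⁻¹)) * ‖u‖ * ‖v‖ *
        (1 - lam)⁻¹) * (1 - lam)⁻¹ * ∫ s, W s ∂M.init) (𝓝 θs) (𝓝 0) := by
      have : Continuous fun θ : E nθ => C * ‖θ - θs‖ * ((C + C * (C * (1 - lam)⁻¹)) * ‖u‖ * ‖v‖ *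
        (1 - lam)⁻¹) * (1 - lam)⁻¹ * ∫ s, W s ∂M.init := by fun_prop
      simpa using this.tendsto θs
    refine squeeze_zero_norm' ?_ hz
    filter_upwards [hball] with θ hθ
    exact h.abs_integral_occ_sub_le h.W_integrable hθ (hbd θ hθ)
  have hself : M.H π θs i j = ∫ s,
      fderiv ℝ (fderiv ℝ (M.lookahead π (M.V (π θs)) s)) θs u v ∂M.occ M.init (π θs) := by
    simp only [H, Matrix.of_apply, h.hessIntegrand_eq h.mem_self, u, v]
  rw [hself, ← add_zero (∫ s, _ ∂_)]
  refine (hmain.add herr).congr' ?_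
  filter_upwards [hball] with θ hθ
  simp only [H, Matrix.of_apply, h.hessIntegrand_eq hθ, u, v]
  ring

end LocalBounds

end MDP

/-! ### Compact state spaces -/

namespace MDP

variable {ns na nθ : ℕ} {M : MDP ns na} {π : E nθ → M.S → E na}

theorem exists_localBounds_of_isCompact (hS : IsCompact M.S) (hγ : M.γ < 1)
    (h₁ : M.FirstOrderRegular π) (h₂ : M.SecondOrderRegular π) (θs : E nθ) :
    ∃ W C lam r, M.LocalBounds π θs W C lam r := by
  have : CompactSpace M.S := isCompact_iff_compactSpace.1 hS
  have hp := smoothFamily_density h₁ h₂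
  have hℓ := smoothFamily_cost h₁ h₂
  have hK {Y : Type} [TopologicalSpace Y] [CompactSpace Y] :
      IsCompact (Metric.closedBall θs 1 ×ˢ (Set.univ : Set Y)) :=
    (isCompact_closedBall θs 1).prod isCompact_univ
  obtain ⟨c₀, hc₀⟩ := hK.exists_bound_of_continuousOn hℓ.continuous.continuousOn
  obtain ⟨c₁, hc₁⟩ := hK.exists_bound_of_continuousOn hℓ.continuous_fderiv.continuousOn
  obtain ⟨c₂, hc₂⟩ := hK.exists_bound_of_continuousOn
    (E := E nθ →L[ℝ] E nθ →L[ℝ] ℝ) hℓ.continuous_fderiv₂.continuousOn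
  obtain ⟨d₁, hd₁⟩ := hK.exists_bound_of_continuousOn hp.continuous_fderiv.continuousOn
  obtain ⟨d₂, hd₂⟩ := hK.exists_bound_of_continuousOn
    (E := E nθ →L[ℝ] E nθ →L[ℝ] ℝ) hp.continuous_fderiv₂.continuousOn
  obtain ⟨b, L, -, -, -, hL⟩ := h₁.bounds
  obtain ⟨B, hB, -⟩ := h₂.bounds
  have hleb : leb M.S Set.univ < ⊤ := by
    rw [leb, comap_subtype_coe_apply M.measurableSet_S, Set.image_univ, Subtype.range_coe]
    exact hS.measure_lt_top
  have hinit : IsFiniteMeasure M.init := by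
    refine ⟨?_⟩
    rw [init, withDensity_apply _ MeasurableSet.univ, Measure.restrict_univ, M.lintegral_p₁]
    exact ENNReal.one_lt_top
  have hsub {θ : E nθ} (hθ : θ ∈ Metric.ball θs 1) {Y : Type} (y : Y) :
      (θ, y) ∈ Metric.closedBall θs 1 ×ˢ (Set.univ : Set Y) :=
    ⟨Metric.ball_subset_closedBall hθ, Set.mem_univ y⟩
  set m := (leb M.S Set.univ).toReal
  set d := max (max d₁ d₂) 0
  set C := max (max c₀ (max c₁ c₂)) (d * m)
  have hd0 : 0 ≤ d := le_max_right _ _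
  have hdm : 0 ≤ d * m := mul_nonneg hd0 ENNReal.toReal_nonneg
  have hC₀ : c₀ ≤ C := (le_max_left _ _).trans (le_max_left _ _)
  have hC₁ : c₁ ≤ C := ((le_max_left _ _).trans (le_max_right _ _)).trans (le_max_left _ _)
  have hC₂ : c₂ ≤ C := ((le_max_right _ _).trans (le_max_right _ _)).trans (le_max_left _ _)
  have hconst (c : ℝ) : ∫⁻ _, ENNReal.ofReal c * ENNReal.ofReal 1 ∂leb M.S =
      ENNReal.ofReal c * leb M.S Set.univ := by
    simp
  -- The weight `1` is contracted by exactly `γ`, since the transition densities have mass one. Here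
  -- `C` dominates the suprema over the compact unit ball times `S`, and `d * m` is the mass of the
  -- constant envelope `d`.
  refine ⟨fun _ => 1, C, M.γ, 1, h₁, h₂, measurable_const, fun _ => zero_le_one,
    integrable_const 1, hdm.trans (le_max_right _ _), M.γ_pos.le, hγ, one_pos, ?_, ?_, ?_, ?_⟩
  · intro θ _ s
    simp [M.lintegral_p s _ (h₁.mapsTo θ s)]
  · intro θ hθ s
    simp only [mul_one]
    exact ⟨(hc₀ _ (hsub hθ s)).trans hC₀, (hc₁ _ (hsub hθ s)).trans hC₁,
      (hc₂ _ (hsub hθ s)).trans hC₂⟩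
  · intro s
    refine ⟨fun _ => d, measurable_const, fun θ hθ s' => ⟨?_, ?_⟩, ?_⟩
    · exact (hd₁ _ (hsub hθ (s, s'))).trans ((le_max_left _ _).trans (le_max_left _ _))
    · exact (hd₂ _ (hsub hθ (s, s'))).trans ((le_max_right _ _).trans (le_max_left _ _))
    · rw [hconst, mul_one, ← ENNReal.ofReal_toReal hleb.ne, ← ENNReal.ofReal_mul hd0]
      exact ENNReal.ofReal_le_ofReal (le_max_right _ _)
  · intro θ _ s
    refine ⟨M.A, M.isOpen_A.mem_nhds (h₁.mapsTo θ s), fun _ => max L B, measurable_const,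
      fun a ha s' => ⟨(hL s a ha s').le.trans (le_max_left _ _),
        (hB s a ha s').le.trans (le_max_right _ _)⟩, ?_⟩
    rw [hconst]
    exact ENNReal.mul_lt_top ENNReal.ofReal_lt_top hleb

end MDP

/-! ### Local convergence of quasi-Newton iterations -/

section quasiNewton

variable {n : ℕ}

theorem continuous_toEuclideanCLM : Continuous fun A : Matrix (Fin n) (Fin n) ℝ =>
    Matrix.toEuclideanCLM (n := Fin n) (𝕜 := ℝ) A :=
  LinearMap.continuous_of_finiteDimensional
    (Matrix.toEuclideanCLM (n := Fin n) (𝕜 := ℝ)).toAlgEquiv.toLinearMap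

theorem tendsto_matrix_inv {α : Type*} {l : Filter α} {A : α → Matrix (Fin n) (Fin n) ℝ}
    {A₀ : Matrix (Fin n) (Fin n) ℝ} (hA : Tendsto A l (𝓝 A₀)) (h₀ : IsUnit A₀) :
    Tendsto (fun a => (A a)⁻¹) l (𝓝 A₀⁻¹) := by
  have hdet : A₀.det ≠ 0 := ((Matrix.isUnit_iff_isUnit_det A₀).1 h₀).ne_zero
  have hd : Continuous fun A : Matrix (Fin n) (Fin n) ℝ => A.det := continuous_id.matrix_det
  have ha : Continuous fun A : Matrix (Fin n) (Fin n) ℝ => A.adjugate :=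
    continuous_id.matrix_adjugate
  simp only [Matrix.inv_def, Ring.inverse_eq_inv']
  exact (((hd.tendsto A₀).comp hA).inv₀ hdet).smul ((ha.tendsto A₀).comp hA)

/-- Symmetry is needed because differentiating the `k`-th partial derivative gives the `k`-th column
of `hessian`, whereas the matrix acts through its `k`-th row. -/
theorem hasFDerivAt_gradient {f : E n → ℝ} {x : E n} (hf : DifferentiableAt ℝ (fderiv ℝ f) x)
    (hsymm : (hessian f x).IsSymm) :
    HasFDerivAt (gradient f) (Matrix.toEuclideanCLM (n := Fin n) (𝕜 := ℝ) (hessian f x)) x := by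
  rw [← hasFDerivWithinAt_univ, hasFDerivWithinAt_euclidean]
  intro k
  rw [hasFDerivWithinAt_univ]
  have h1 : HasFDerivAt (fun y => fderiv ℝ f y (EuclideanSpace.single k 1))
      ((fderiv ℝ (fderiv ℝ f) x).flip (EuclideanSpace.single k 1)) x := by
    simpa using hf.hasFDerivAt.clm_apply (hasFDerivAt_const (EuclideanSpace.single k (1 : ℝ)) x)
  simp_rw [gradient_apply]
  refine h1.congr_fderiv (ContinuousLinearMap.ext fun v => ?_)
  have hk : (EuclideanSpace.proj k ∘L Matrix.toEuclideanCLM (n := Fin n) (𝕜 := ℝ) (hessian f x)) v =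
      ∑ l, hessian f x k l * v l := rfl
  rw [clm_apply_eq_sum ((fderiv ℝ (fderiv ℝ f) x).flip _) v]
  refine Eq.trans (Finset.sum_congr rfl fun l _ => ?_) hk.symm
  rw [mul_comm, ← hsymm.apply]
  rfl

theorem isLittleO_clm_apply {α V : Type*} [NormedAddCommGroup V] [NormedSpace ℝ V] {l : Filter α}
    {T : α → V →L[ℝ] V} (hT : Tendsto T l (𝓝 0)) (e : α → V) : (fun k => T k (e k)) =o[l] e := by
  have h1 : (fun k => ‖T k‖ * ‖e k‖) =o[l] fun k => (1 : ℝ) * ‖e k‖ :=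
    ((isLittleO_one_iff ℝ).2 (by simpa using hT.norm)).mul_isBigO (isBigO_refl _ _)
  simp only [one_mul] at h1
  exact ((IsBigO.of_norm_le fun k => (T k).le_opNorm _).trans_isLittleO h1).of_norm_right

theorem isLittleO_clm_apply_of_tendsto {α V : Type*} [NormedAddCommGroup V] [NormedSpace ℝ V]
    {l : Filter α} {T : α → V →L[ℝ] V} {T₀ : V →L[ℝ] V} (hT : Tendsto T l (𝓝 T₀)) {ρ e : α → V}
    (hρ : ρ =o[l] e) : (fun k => T k (ρ k)) =o[l] e := by
  have h1 : (fun k => ‖T k‖ * ‖ρ k‖) =o[l] fun k => (1 : ℝ) * ‖e k‖ :=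
    (hT.norm.isBigO_one ℝ).mul_isLittleO hρ.norm_norm
  simp only [one_mul] at h1
  exact ((IsBigO.of_norm_le fun k => (T k).le_opNorm _).trans_isLittleO h1).of_norm_right

/-- A convergent quasi-Newton iteration whose matrices tend to the Hessian at the limit, a
nondegenerate critical point, converges superlinearly. -/
theorem superlinearlyConverges_of_quasiNewton {f : E n → ℝ} {x : E n}
    {B : E n → Matrix (Fin n) (Fin n) ℝ} (hf : DifferentiableAt ℝ (fderiv ℝ f) x)
    (hgrad : gradient f x = 0) (hpos : (hessian f x).PosDef)
    (hB : Tendsto B (𝓝 x) (𝓝 (hessian f x))) {θ : ℕ → E n}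
    (hstep : ∀ k, θ (k + 1) = θ k - Matrix.toEuclideanLin (B (θ k))⁻¹ (gradient f (θ k)))
    (hconv : Tendsto θ atTop (𝓝 x)) : SuperlinearlyConverges θ x := by
  refine ⟨hconv, ?_⟩
  set A := hessian f x
  set Φ := Matrix.toEuclideanCLM (n := Fin n) (𝕜 := ℝ)
  have hsymm : A.IsSymm := by simpa [Matrix.IsHermitian, Matrix.IsSymm] using hpos.isHermitian
  have hinv := tendsto_matrix_inv (hB.comp hconv) hpos.isUnit
  have hρ : (fun k => gradient f (θ k) - Φ A (θ k - x)) =o[atTop] fun k => θ k - x := by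
    have := (hasFDerivAt_gradient hf hsymm).isLittleO.comp_tendsto hconv
    simpa [hgrad, Function.comp_def] using this
  have h1 : Tendsto (fun k => Φ (1 - (B (θ k))⁻¹ * A)) atTop (𝓝 0) := by
    have hm : Tendsto (fun k => 1 - (B (θ k))⁻¹ * A) atTop (𝓝 (1 - A⁻¹ * A)) :=
      tendsto_const_nhds.sub (hinv.mul tendsto_const_nhds)
    rw [Matrix.nonsing_inv_mul _ ((Matrix.isUnit_iff_isUnit_det A).1 hpos.isUnit), sub_self] at hm
    rw [← map_zero Φ]
    exact (continuous_toEuclideanCLM.tendsto 0).comp hm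
  have h2 : Tendsto (fun k => Φ (B (θ k))⁻¹) atTop (𝓝 (Φ A⁻¹)) :=
    (continuous_toEuclideanCLM.tendsto A⁻¹).comp hinv
  refine ((isLittleO_clm_apply h1 fun k => θ k - x).sub
    -- The first term has an operator tending to `0`; the second has a convergent operator applied
    -- to the Taylor remainder of the gradient.
    (isLittleO_clm_apply_of_tendsto h2 hρ)).congr_left fun k => ?_
  have hlin : Matrix.toEuclideanLin (B (θ k))⁻¹ (gradient f (θ k)) =
      Φ (B (θ k))⁻¹ (gradient f (θ k)) := rfl
  rw [hstep k, hlin, map_sub Φ, map_mul, map_one]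
  simp only [sub_apply, one_apply_eq_self, mul_apply_eq_comp, map_sub]
  abel

end quasiNewton

end QNPolicy

end

theorem mainTheorem3 {ns na nθ : ℕ} (M : QNPolicy.MDP ns na)
    (π : QNPolicy.E nθ → M.S → QNPolicy.E na) (θs : QNPolicy.E nθ)
    (h₁ : M.FirstOrderRegular π) (h₂ : M.SecondOrderRegular π)
    (hreg : (IsCompact M.S ∧ M.γ < 1) ∨ M.LocallyDominated π θs)
    (hrich : M.IsOptimal (π θs))
    (hHess : QNPolicy.LipschitzInvertibleHessianNear (M.J π) θs)
    (hgrad : gradient (M.J π) θs = 0)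
    (hpos : (QNPolicy.hessian (M.J π) θs).PosDef)
    (θ : ℕ → QNPolicy.E nθ)
    (hstep : ∀ k, θ (k + 1) =
      θ k - Matrix.toEuclideanLin (M.H π (θ k))⁻¹ (gradient (M.J π) (θ k)))
    (hconv : Tendsto θ atTop (𝓝 θs)) :
    QNPolicy.SuperlinearlyConverges θ θs := by
  obtain ⟨W, C, lam, r, h⟩ : ∃ W C lam r, M.LocalBounds π θs W C lam r := by
    rcases hreg with ⟨hS, hγ⟩ | hdom
    · exact QNPolicy.MDP.exists_localBounds_of_isCompact hS hγ h₁ h₂ θs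
    · exact hdom.exists_localBounds h₁ h₂
  obtain ⟨U, hU, hθU, hJ, -, -⟩ := hHess
  have hJd : ∀ᶠ ϑ in 𝓝 θs, DifferentiableAt ℝ (M.J π) ϑ := by
    filter_upwards [hU.mem_nhds hθU] with ϑ hϑ
    exact (hJ.differentiableOn two_ne_zero).differentiableAt (hU.mem_nhds hϑ)
  have hJ₂ : DifferentiableAt ℝ (fderiv ℝ (M.J π)) θs :=
    ((hJ.contDiffAt (hU.mem_nhds hθU)).fderiv_right (m := 1) (by norm_num)).differentiableAt
      one_ne_zero
  have hJ0 : fderiv ℝ (M.J π) θs = 0 := by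
    simpa [gradient] using hgrad
  refine QNPolicy.superlinearlyConverges_of_quasiNewton hJ₂ hgrad hpos ?_ hstep hconv
  rw [← h.H_self hrich hJd hJ₂ hJ0]
  exact h.tendsto_H
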